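/- Let $\zeta=(\zeta(t))_{t\in\mathbb Z}$ be a real, zero-mean, (wide-sense) stationary $p$-dimensional process with rational spectral density $\Phi(z)$ of rank $m$; for instance, the latent process in a dynamic factor model $\eta=\zeta+\omega$. Let $u$ be a minimal factor process of $\zeta$, that is, after a rearrangement of the components $\zeta=\begin{bmatrix}u\\ y\end{bmatrix}$, where $u$ is an $m$-dimensional subvector whose spectral density $\Phi_u$ has full rank $m$, and partition $\Phi=\begin{bmatrix}\Phi_u&\Phi_{uy}\\ \Phi_{yu}&\Phi_y\end{bmatrix}$ accordingly. Then: 1. $y=F(z)u$ for the rational matrix $F=\Phi_{yu}\Phi_u^{-1}$, and $F$ is the only rational matrix with this property. 2. $u$ can be constructed by a noisy feedback on the remaining variables $y$: there are a proper rational matrix $H(z)$ and a stationary process $r$ that has a rational spectral density of full rank $m$, such that $$y=F(z)u,\qquad u=H(z)y+r,$$ and this feedback loop is internally stable: $\begin{bmatrix}I&-H\\-F&I\end{bmatrix}$ is invertible as a rational matrix, and its inverse, the transfer function from $(r,v)$ to $(u,y)$ in the loop $y=F(z)u+v$, $u=H(z)y+r$, is strictly stable, i.e. analytic in $\{|z|\ge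 1\}\cup\{\infty\}$. Here $z$ is the shift, $zu(t)=u(t+1)$, and for a rational matrix $G$ whose rows lie in $L^2(\Phi_x\,d\theta/2\pi)$ on the unit circle, $G(z)x$ denotes the stationary process $\int_{-\pi}^{\pi} e^{it\theta}G(e^{i\theta})\,d\hat x$, where $x(t)=\int_{-\pi}^{\pi} e^{it\theta}\,d\hat x$ is the spectral representation of the stationary process $x$ with spectral density $\Phi_x$. (The transfer functions $F$ and $H$ themselves are not required to be stable.) -/

import Mathlib

open MeasureTheory

noncomputable section

namespace FactorModel

/-- A real rational function evaluated at a complex number. -/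
def evalC (f : RatFunc ℝ) (z : ℂ) : ℂ := RatFunc.eval (algebraMap ℝ ℂ) z f

/-- The point `e^{iθ}` of the unit circle. -/
def circ (θ : ℝ) : ℂ := Complex.exp (Complex.I * θ)

/-- The matrix `Φ(e^{iθ})` (its entries are the true values except at the finitely many poles). -/
def evalCirc {κ ι : Type*} (Φ : Matrix κ ι (RatFunc ℝ)) (θ : ℝ) : Matrix κ ι ℂ :=
  Matrix.of fun i j => evalC (Φ i j) (circ θ)

/-- A rational function is proper if it is finite at infinity. -/
def IsProper (f : RatFunc ℝ) : Prop := f.num.natDegree ≤ f.denom.natDegree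

/-- A rational function is strictly stable if it is analytic in the complement of the open unit
disc, the point at infinity included. -/
def IsStrictlyStable (f : RatFunc ℝ) : Prop :=
  IsProper f ∧ ∀ z : ℂ, 1 ≤ ‖z‖ → Polynomial.aeval z f.denom ≠ 0

/-- A zero-mean, square integrable vector process `x` whose covariances
`E x_i(t+k) x_j(t)` do not depend on `t`. -/
structure IsStationary {Ω : Type*} [MeasurableSpace Ω] (P : Measure Ω) {ι : Type*}
    (x : ℤ → Ω → ι → ℝ) : Prop where
  memLp : ∀ t i, MemLp (fun ω => x t ω i) 2 P
  mean_zero : ∀ t i, ∫ ω, x t ω i ∂P = 0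
  covariance : ∀ t k i j,
    ∫ ω, x (t + k) ω i * x t ω j ∂P = ∫ ω, x k ω i * x 0 ω j ∂P

/-- The stationary process `x` has the rational spectral density `Φ`: `Φ(e^{iθ})` is integrable and
`E x(k) x(0)' = (1/2π) ∫ e^{ikθ} Φ(e^{iθ}) dθ` for all `k`. -/
structure HasSpectralDensity {Ω : Type*} [MeasurableSpace Ω] (P : Measure Ω) {ι : Type*}
    (x : ℤ → Ω → ι → ℝ) (Φ : Matrix ι ι (RatFunc ℝ)) : Prop where
  stationary : IsStationary P x
  integrable : ∀ i j,
    IntegrableOn (fun θ : ℝ => evalCirc Φ θ i j) (Set.Ioc (-Real.pi) Real.pi)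
  covariance_eq : ∀ (k : ℤ) (i j : ι),
    ((∫ ω, x k ω i * x 0 ω j ∂P : ℝ) : ℂ) =
      (1 / (2 * Real.pi) : ℂ) *
        ∫ θ in Set.Ioc (-Real.pi) Real.pi, circ θ ^ k * evalCirc Φ θ i j

/-- The squared norm `(1/2π) ∫ g Φ g^* dθ` of a row-vector function `g` on the circle, in the space
`L²(Φ dθ/2π)`. -/
def spectralEnergy {ι : Type*} [Fintype ι] (Φ : Matrix ι ι (RatFunc ℝ)) (g : ℝ → ι → ℂ) : ENNReal :=
  ENNReal.ofReal (1 / (2 * Real.pi)) *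
    ∫⁻ θ in Set.Ioc (-Real.pi) Real.pi,
      ENNReal.ofReal ((g θ) ⬝ᵥ (Matrix.mulVec (evalCirc Φ θ) (star (g θ)))).re

/-- The transfer function `∑ c_k z^k` of a finite filter, at `z = e^{iθ}`. -/
def finTransfer {ι : Type*} (c : ℤ →₀ (ι → ℝ)) (θ : ℝ) : ι → ℂ :=
  fun i => c.sum fun k a => (a i : ℂ) * circ θ ^ k

/-- The output `∑ c_k u(t+k)` of a finite filter (recall `z u(t) = u(t+1)`). -/
def finOutput {Ω ι : Type*} [Fintype ι] (c : ℤ →₀ (ι → ℝ)) (u : ℤ → Ω → ι → ℝ) (t : ℤ) (ω : Ω) : ℝ :=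
  c.sum fun k a => ∑ i, a i * u (t + k) ω i

/-- `y = F(z) u`, for an input `u` with spectral density `Φ`. This is the linear filtering
`y(t) = ∫ e^{itθ} F(e^{iθ}) dû` of stationary processes: each row of `F` lies in `L²(Φ dθ/2π)`, and
`y_j(t)` is the mean square limit of finite filters of `u` whose transfer functions converge in
`L²(Φ dθ/2π)` to the `j`-th row of `F`. Neither causality nor stability of `F` is required. -/
def IsFilterOutput {Ω : Type*} [MeasurableSpace Ω] (P : Measure Ω) {κ ι : Type*} [Fintype ι]
    (Φ : Matrix ι ι (RatFunc ℝ)) (F : Matrix κ ι (RatFunc ℝ))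
    (u : ℤ → Ω → ι → ℝ) (y : ℤ → Ω → κ → ℝ) : Prop :=
  (∀ t j, MemLp (fun ω => y t ω j) 2 P) ∧
  ∀ (j : κ) (ε : ENNReal), 0 < ε → ∃ c : ℤ →₀ (ι → ℝ),
    spectralEnergy Φ (fun θ i => evalCirc F θ j i - finTransfer c θ i) < ε ∧
    ∀ t, eLpNorm (fun ω => y t ω j - finOutput c u t ω) 2 P < ε

/-- The matrix `R(z)` of the feedback loop `u = H y + r`, `y = F u + v`, for which
`R(z) [u; y] = [r; v]`. -/
def loopMatrix {κ ι : Type*} [DecidableEq κ] [DecidableEq ι]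
    (F : Matrix κ ι (RatFunc ℝ)) (H : Matrix ι κ (RatFunc ℝ)) :
    Matrix (ι ⊕ κ) (ι ⊕ κ) (RatFunc ℝ) :=
  Matrix.fromBlocks 1 (-H) (-F) 1

/-- The feedback loop is internally stable: it is well posed, and the transfer function
`T(z) = R(z)⁻¹` from the inputs `[r; v]` to `[u; y]` is strictly stable. -/
def IsInternallyStable {κ ι : Type*} [Fintype κ] [Fintype ι] [DecidableEq κ] [DecidableEq ι]
    (F : Matrix κ ι (RatFunc ℝ)) (H : Matrix ι κ (RatFunc ℝ)) : Prop :=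
  IsUnit (loopMatrix F H).det ∧ ∀ a b, IsStrictlyStable ((loopMatrix F H)⁻¹ a b)

/-- The subvector process of `x` with the components selected by `s`. -/
def subprocess {Ω ι κ : Type*} (x : ℤ → Ω → ι → ℝ) (s : κ → ι) : ℤ → Ω → κ → ℝ :=
  fun t ω k => x t ω (s k)

/-- The data of the noisy feedback `y = F(z) u`, `u = H(z) y + r`, where `u` and `y` have spectral
densities `Φu` and `Φy`: `H` is proper, the loop is internally stable, and `r` is a stationary process
with a rational spectral density of full rank. -/
structure IsNoisyFeedback {Ω : Type*} [MeasurableSpace Ω] (P : Measure Ω) {κ ι : Type*}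
    [Fintype κ] [Fintype ι] [DecidableEq κ] [DecidableEq ι]
    (Φu : Matrix ι ι (RatFunc ℝ)) (Φy : Matrix κ κ (RatFunc ℝ))
    (u : ℤ → Ω → ι → ℝ) (y : ℤ → Ω → κ → ℝ)
    (F : Matrix κ ι (RatFunc ℝ)) (H : Matrix ι κ (RatFunc ℝ)) (r : ℤ → Ω → ι → ℝ) : Prop where
  /-- `y = F(z) u` -/
  forward : IsFilterOutput P Φu F u y
  /-- `u = H(z) y + r` -/
  feedback : IsFilterOutput P Φy H y (fun t ω i => u t ω i - r t ω i)
  proper : ∀ i j, IsProper (H i j)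
  internally_stable : IsInternallyStable F H
  noise_full_rank : ∃ Φr : Matrix ι ι (RatFunc ℝ),
    HasSpectralDensity P r Φr ∧ Φr.rank = Fintype.card ι

end FactorModel

end

noncomputable section

namespace FactorModel

/-! Forward part. Since `Φ` and its block `Φ_u` have the same rank, the columns through `Φ_u` span
all columns, so the Schur complement of `Φ_u` vanishes. A spectral density is positive semidefinite
a.e. on the circle (`HasSpectralDensity.ae_isNonneg`), hence para-Hermitian, and therefore `Φ = [1;
F] Φ_u [1; F]^*` with `F = Φ_yu Φ_u⁻¹`. By the isometry between finite filters and `L²(Φ dθ/2π)`,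
the mean square error of predicting `y_j` by a finite filter `c` of `u` is the squared distance from
`F_j` to `c` in `L²(Φ_u dθ/2π)` (`HasSpectralDensity.eLpNorm_sub_finOutput_sq`). Density of finite
filters gives `y = F u`; nonsingularity of `Φ_u` a.e. gives uniqueness.

Feedback part. The construction of `H` is algebraic and works for every rational `F`
(`exists_stabilizing_feedback`). A Smith form over the polynomials reduces `F` to scalars `f = n/d`.
If `x d + y n = 1` and `h = -y/x`, then `1 - h f = 1/(x d)`, so the closed loop is polynomial. Doing
this for `F(z⁻¹)` and substituting back gives a closed loop polynomial in `z⁻¹`, whose only pole is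
`0`. The freedom `x ↦ x + t n` keeps `x` nonzero at `0`, which makes `H` proper, and on the unit
circle, which makes `H` bounded there.

Boundedness ensures that `H y` exists as a mean square limit. The residual `r = u - H y` then has
density `S Φ_u S^*` with `S = 1 - H F`, and `det S` is the determinant of the loop matrix, hence
nonzero. -/

/-! ### Bézout cofactors without zeros on the unit circle and at `0`. -/

-- On the circle the conjugate of `z` is `z⁻¹`, and `f` has real coefficients; reflection thus
-- expresses conjugation by a polynomial.
open Polynomial in
theorem aeval_reflect_mul_conj_pow {N : ℕ} {f : ℝ[X]} (hf : f.natDegree ≤ N) {z : ℂ} (hz : ‖z‖ = 1) :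
    aeval z (reflect N f) * (starRingEnd ℂ z) ^ N = starRingEnd ℂ (aeval z f) := by
  have hz0 : z ≠ 0 := by
    rintro rfl
    simp at hz
  have hinv : starRingEnd ℂ z = z⁻¹ := (Complex.inv_eq_conj hz).symm
  let _ : Invertible (starRingEnd ℂ z) := ⟨z, by rw [hinv]; field_simp, by rw [hinv]; field_simp⟩
  have h := eval₂_reflect_mul_pow (algebraMap ℝ ℂ) (starRingEnd ℂ z) N f hf
  have h2 : aeval (starRingEnd ℂ z) f = starRingEnd ℂ (aeval z f) :=
    aeval_algHom_apply Complex.conjAe.toAlgHom z f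
  rw [← h2]
  exact h

-- On the circle, the last polynomial vanishes exactly where `a` times the conjugate of `φ b` is
-- real. Its being nonzero leaves only finitely many points at which `a / (φ b)` can take a real
-- value.
open Polynomial in
theorem exists_mul_reflect_sub_ne_zero {a b : ℝ[X]} (ha : a ≠ 0) (hb : b ≠ 0) :
    ∃ (φ : ℝ[X]) (N : ℕ), φ.eval 0 ≠ 0 ∧ (∀ z : ℂ, ‖z‖ = 1 → aeval z φ ≠ 0) ∧
      a.natDegree ≤ N ∧ (φ * b).natDegree ≤ N ∧
      a * reflect N (φ * b) - reflect N a * (φ * b) ≠ 0 := by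
  set M := max a.natDegree b.natDegree with hM
  have haM : a.natDegree ≤ M := le_max_left _ _
  have hbM : b.natDegree ≤ M := le_max_right _ _
  have hd : (X + C 2 : ℝ[X]).natDegree ≤ 1 := by compute_degree
  have h1 : reflect (1 + M) (1 * b) = X * reflect M b := by
    rw [reflect_mul 1 b (by simp) hbM]
    congr 1
    simpa only [map_one, one_mul, pow_one] using reflect_C (1 : ℝ) 1
  have h2 : reflect (1 + M) ((X + C 2) * b) = (1 + C 2 * X) * reflect M b := by
    rw [reflect_mul _ b hd hbM, reflect_add, reflect_one_X, reflect_C, pow_one]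
  -- If `φ = 1` fails, then `φ = X + 2` works: combining the two vanishing identities would give `a
  -- * reflect M b * (1 - X ^ 2) = 0`.
  by_cases hP : a * reflect (1 + M) (1 * b) - reflect (1 + M) a * (1 * b) = 0
  · refine ⟨X + C 2, 1 + M, by simp, ?_, by omega, natDegree_mul_le.trans (by omega), ?_⟩
    · intro z hz h
      have h' : z = -2 := by
        have : z + 2 = 0 := by simpa using h
        linear_combination this
      rw [h'] at hz
      norm_num at hz
    · intro h
      rw [h1] at hP
      rw [h2] at h
      have hX : (1 - X ^ 2 : ℝ[X]) ≠ 0 := by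
        intro h0
        have := congrArg (eval 0) h0
        simp at this
      have : a * reflect M b * (1 - X ^ 2) = 0 := by
        have e : (C 2 : ℝ[X]) = 2 := rfl
        rw [e] at h
        linear_combination h - (X + 2) * hP
      simp [ha, hb, hX] at this
  · exact ⟨1, 1 + M, by simp, by simp, by omega, by rw [one_mul]; omega, hP⟩

-- Take `t = τ φ` with `τ` real. A zero on the circle forces `τ = -a / (φ b)` at a point where this
-- quotient is real, so finitely many values of `τ` are excluded. Common zeros of `a` and `b` are
-- ruled out by coprimality.
open Polynomial in
theorem exists_add_mul_ne_zero {a b : ℝ[X]} (h : IsCoprime a b) :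
    ∃ t : ℝ[X], (a + t * b).eval 0 ≠ 0 ∧ ∀ z : ℂ, ‖z‖ = 1 → aeval z (a + t * b) ≠ 0 := by
  have unit_case : ∀ {u : ℝ[X]}, IsUnit u → u.eval 0 ≠ 0 ∧ ∀ z : ℂ, ‖z‖ = 1 → aeval z u ≠ 0 :=
    fun hu => ⟨(hu.map (evalRingHom (0 : ℝ))).ne_zero, fun z _ => (hu.map (aeval z)).ne_zero⟩
  by_cases ha : a = 0
  · subst ha
    exact ⟨1, by simpa using unit_case (isCoprime_zero_left.mp h)⟩
  by_cases hb : b = 0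
  · subst hb
    exact ⟨0, by simpa using unit_case (isCoprime_zero_right.mp h)⟩
  obtain ⟨φ, N, hφ0, hφ, haN, hbN, hP⟩ := exists_mul_reflect_sub_ne_zero ha hb
  set P := a * reflect N (φ * b) - reflect N a * (φ * b)
  -- The real part only brings the excluded values into `ℝ`; at the relevant roots the quotient is
  -- already real. The extra singleton handles the point `0`.
  have hfin : (((fun z : ℂ => (-(aeval z a) / aeval z (φ * b)).re) '' (P.rootSet ℂ)) ∪
      {-(a.eval 0) / (φ * b).eval 0}).Finite :=
    ((rootSet_finite P ℂ).image _).union (Set.finite_singleton _)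
  obtain ⟨τ, hτ⟩ := hfin.exists_notMem
  simp only [Set.mem_union, Set.mem_image, Set.mem_singleton_iff, not_or, not_exists, not_and] at hτ
  obtain ⟨u, v, huv⟩ := h
  refine ⟨C τ * φ, ?_, ?_⟩
  · intro h0
    simp only [eval_add, eval_mul, eval_C] at h0
    have huv0 := congrArg (eval 0) huv
    simp only [eval_add, eval_mul, eval_one] at huv0
    by_cases hb0 : b.eval 0 = 0
    · rw [hb0] at h0 huv0
      have ha0 : a.eval 0 = 0 := by linear_combination h0
      rw [ha0] at huv0
      simp at huv0
    · apply hτ.2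
      rw [eval_mul]
      field_simp
      linear_combination h0
  · intro z hz h0
    simp only [map_add, map_mul, aeval_C] at h0
    have huv0 := congrArg (aeval z) huv
    simp only [map_add, map_mul, map_one] at huv0
    by_cases hb0 : aeval z b = 0
    · rw [hb0] at h0 huv0
      have ha0 : aeval z a = 0 := by linear_combination h0
      rw [ha0] at huv0
      simp at huv0
    · have hB : aeval z (φ * b) ≠ 0 := by
        rw [map_mul]
        exact mul_ne_zero (hφ z hz) hb0
      have hτz : aeval z a = -(τ : ℂ) * aeval z (φ * b) := by
        rw [map_mul]
        have : (algebraMap ℝ ℂ) τ = (τ : ℂ) := rfl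
        rw [this] at h0
        linear_combination h0
      refine hτ.1 z ?_ ?_
      · rw [mem_rootSet]
        refine ⟨hP, ?_⟩
        have hc : (starRingEnd ℂ z) ^ N ≠ 0 := by
          apply pow_ne_zero
          intro hz0
          rw [map_eq_zero] at hz0
          rw [hz0] at hz
          simp at hz
        have e1 := aeval_reflect_mul_conj_pow haN hz
        have e2 := aeval_reflect_mul_conj_pow hbN hz
        have : aeval z P * (starRingEnd ℂ z) ^ N = 0 := by
          simp only [P, map_sub, map_mul (aeval z) a, map_mul (aeval z) (reflect N a)]
          rw [hτz, map_mul, map_neg, Complex.conj_ofReal] at e1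
          linear_combination (aeval z a) * e2 - (aeval z (φ * b)) * e1 +
            (starRingEnd ℂ (aeval z (φ * b))) * hτz
        exact (mul_eq_zero.mp this).resolve_right hc
      · rw [hτz, neg_mul, neg_neg, mul_div_cancel_right₀ _ hB, Complex.ofReal_re]

/-- A Bézout identity whose first cofactor does not vanish on the unit circle and at `0`. -/
theorem exists_bezout_ne_zero {n d : Polynomial ℝ} (h : IsCoprime n d) :
    ∃ x y : Polynomial ℝ, x * d + y * n = 1 ∧ x.eval 0 ≠ 0 ∧
      ∀ z : ℂ, ‖z‖ = 1 → Polynomial.aeval z x ≠ 0 := by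
  obtain ⟨y, x, hxy⟩ := h
  -- All solutions `(x + t n, y - t d)` are available, and the identity itself makes `x` and `n`
  -- coprime.
  have hc : IsCoprime x n := ⟨d, y, by linear_combination hxy⟩
  obtain ⟨t, h0, ht⟩ := exists_add_mul_ne_zero hc
  exact ⟨x + t * n, y - t * d, by linear_combination hxy, h0, ht⟩

/-! ### Smith form and the polynomial closed loop. -/

/-- Smith normal form of a rectangular matrix over a principal ideal domain: `N = B D Q` with `D`
diagonal, where `B` has a left inverse and `Q` a right inverse. -/
theorem exists_smith_factorization {A : Type*} [CommRing A] [IsDomain A] [IsPrincipalIdealRing A]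
    {κ ι : Type*} [Fintype κ] [Fintype ι] [DecidableEq κ] [DecidableEq ι] (N : Matrix κ ι A) :
    ∃ (k : ℕ) (a : Fin k → A) (B : Matrix κ (Fin k) A) (B' : Matrix (Fin k) κ A)
      (Q : Matrix (Fin k) ι A) (Q' : Matrix ι (Fin k) A),
      N = B * Matrix.diagonal a * Q ∧ B' * B = 1 ∧ Q * Q' = 1 := by
  -- Adapted bases of `A^κ` and of the column module of `N`, with `bN i = a i • bM (f i)`. The
  -- columns of `B` are the vectors `bM (f i)`, `Q` holds the coordinates of the columns of `N` in
  -- `bN`, and `Q'` holds preimages of the `bN i`.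
  obtain ⟨k, S⟩ := Submodule.smithNormalForm (Pi.basisFun A κ) (LinearMap.range N.mulVecLin)
  have hpre : ∀ i, ∃ p : ι → A, N.mulVec p = (S.bN i : κ → A) := fun i => by
    obtain ⟨p, hp⟩ := (S.bN i).2
    exact ⟨p, hp⟩
  choose p hp using hpre
  let R : (ι → A) →ₗ[A] LinearMap.range N.mulVecLin := N.mulVecLin.rangeRestrict
  have hRp : ∀ i, R (p i) = S.bN i := fun i => Subtype.ext (hp i)
  refine ⟨k, S.a, Matrix.of fun l i => S.bM (S.f i) l,
    Matrix.of fun i l => S.bM.repr (Pi.single l 1) (S.f i),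
    Matrix.of fun i l => S.bN.repr (R (Pi.single l 1)) i,
    Matrix.of fun l i => p i l, ?_, ?_, ?_⟩
  · ext l j
    have h1 : (R (Pi.single j 1) : κ → A) l = N l j := by
      change N.mulVec (Pi.single j 1) l = N l j
      simp
    rw [← h1, ← S.bN.sum_repr (R (Pi.single j 1))]
    rw [Matrix.mul_apply]
    simp only [Matrix.mul_diagonal, Matrix.of_apply, Submodule.coe_sum,
      Submodule.coe_smul, S.snf, Finset.sum_apply, Pi.smul_apply, smul_eq_mul]
    refine Finset.sum_congr rfl fun i _ => ?_
    ring
  · ext i i'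
    have h : ∀ v : κ → A, ∑ l, S.bM.repr (Pi.single l 1) (S.f i) * v l = S.bM.repr v (S.f i) := by
      intro v
      conv_rhs => rw [pi_eq_sum_univ' v]
      simp [map_sum, mul_comm]
    simp only [Matrix.mul_apply, Matrix.of_apply, h, Module.Basis.repr_self]
    rw [Finsupp.single_apply, Matrix.one_apply]
    simp [S.f.injective.eq_iff, eq_comm]
  · ext i i'
    have h : ∀ v : ι → A, ∑ l, S.bN.repr (R (Pi.single l 1)) i * v l = S.bN.repr (R v) i := by
      intro v
      conv_rhs => rw [pi_eq_sum_univ' v]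
      simp [map_sum, mul_comm]
    simp only [Matrix.mul_apply, Matrix.of_apply, h, hRp, Module.Basis.repr_self]
    rw [Finsupp.single_apply, Matrix.one_apply]
    simp [eq_comm]

/-- A rational function whose denominator vanishes neither on the unit circle nor at `0`. -/
def IsCircleRegular (f : RatFunc ℝ) : Prop :=
  ∃ a b : Polynomial ℝ, b.eval 0 ≠ 0 ∧ (∀ z : ℂ, ‖z‖ = 1 → Polynomial.aeval z b ≠ 0) ∧
    f = algebraMap _ (RatFunc ℝ) a / algebraMap _ (RatFunc ℝ) b

theorem IsCircleRegular.add {f g : RatFunc ℝ} (hf : IsCircleRegular f) (hg : IsCircleRegular g) :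
    IsCircleRegular (f + g) := by
  obtain ⟨a, b, hb, hb', rfl⟩ := hf
  obtain ⟨c, d, hd, hd', rfl⟩ := hg
  have hb0 : b ≠ 0 := by
    rintro rfl
    simp at hb
  have hd0 : d ≠ 0 := by
    rintro rfl
    simp at hd
  refine ⟨a * d + b * c, b * d, by simp [hb, hd], fun z hz => by simp [hb' z hz, hd' z hz], ?_⟩
  rw [div_add_div _ _ (RatFunc.algebraMap_ne_zero hb0) (RatFunc.algebraMap_ne_zero hd0)]
  simp only [map_add, map_mul]

theorem IsCircleRegular.sum {α : Type*} (s : Finset α) (f : α → RatFunc ℝ)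
    (h : ∀ i ∈ s, IsCircleRegular (f i)) : IsCircleRegular (∑ i ∈ s, f i) :=
  Finset.sum_induction f _ (fun _ _ => IsCircleRegular.add) ⟨0, 1, by simp, by simp, by simp⟩ h

theorem mul_diagonal_mul_add {K α β γ : Type*} [Field K] [Fintype γ] [DecidableEq γ]
    (L : Matrix α γ K) (R : Matrix γ β K) (u v : γ → K) :
    L * Matrix.diagonal (u + v) * R = L * Matrix.diagonal u * R + L * Matrix.diagonal v * R := by
  rw [show Matrix.diagonal (u + v) = Matrix.diagonal u + Matrix.diagonal v from
    (Matrix.diagonal_add u v).symm, Matrix.mul_add, Matrix.add_mul]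

theorem mul_diagonal_mul_mul {K α β γ δ : Type*} [Field K] [Fintype γ] [DecidableEq γ] [Fintype δ]
    (L : Matrix α γ K) (R' : Matrix γ δ K) (L' : Matrix δ γ K) (R : Matrix γ β K) (u v : γ → K)
    (h : R' * L' = 1) :
    L * Matrix.diagonal u * R' * (L' * Matrix.diagonal v * R) = L * Matrix.diagonal (u * v) * R := by
  rw [show Matrix.diagonal (u * v) = Matrix.diagonal u * Matrix.diagonal v from
    (Matrix.diagonal_mul_diagonal u v).symm]
  simp only [Matrix.mul_assoc]
  rw [← Matrix.mul_assoc R' L', h, Matrix.one_mul]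

/-- The closed loop of a diagonalized plant and a diagonalized feedback. -/
theorem loopMatrix_mul_of_diagonal {κ ι γ : Type*} [Fintype κ] [Fintype ι] [DecidableEq κ]
    [DecidableEq ι] [Fintype γ] [DecidableEq γ]
    {b : Matrix κ γ (RatFunc ℝ)} {b' : Matrix γ κ (RatFunc ℝ)}
    {q : Matrix γ ι (RatFunc ℝ)} {q' : Matrix ι γ (RatFunc ℝ)} (hb : b' * b = 1) (hq : q * q' = 1)
    {f h α β δ : γ → RatFunc ℝ} (hδ : h * δ = α) (hβ : β = h + h * α) (hδ' : δ = f + f * α)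
    (hα : f * β = α) :
    loopMatrix (b * Matrix.diagonal f * q) (q' * Matrix.diagonal h * b') *
      Matrix.fromBlocks (1 + q' * Matrix.diagonal α * q) (q' * Matrix.diagonal β * b')
        (b * Matrix.diagonal δ * q) (1 + b * Matrix.diagonal α * b') = 1 := by
  rw [loopMatrix, Matrix.fromBlocks_multiply, ← Matrix.fromBlocks_one]
  simp only [Matrix.one_mul, Matrix.neg_mul, Matrix.mul_add, Matrix.mul_one,
    mul_diagonal_mul_mul _ _ _ _ _ _ hb, mul_diagonal_mul_mul _ _ _ _ _ _ hq, hδ, hα]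
  congr 1
  · abel
  · rw [hβ, mul_diagonal_mul_add]
    abel
  · rw [hδ', mul_diagonal_mul_add]
    abel
  · abel

/-- Every rational transfer matrix is stabilized by a feedback without poles on the unit circle
and at `0`, such that the closed loop is polynomial. -/
theorem exists_polynomial_loop_inverse {κ ι : Type*} [Fintype κ] [Fintype ι] [DecidableEq κ]
    [DecidableEq ι] (F : Matrix κ ι (RatFunc ℝ)) :
    ∃ (H : Matrix ι κ (RatFunc ℝ)) (T : Matrix (ι ⊕ κ) (ι ⊕ κ) (Polynomial ℝ)),
      (∀ i j, IsCircleRegular (H i j)) ∧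
        loopMatrix F H * T.map (algebraMap _ (RatFunc ℝ)) = 1 := by
  set C := algebraMap (Polynomial ℝ) (RatFunc ℝ) with hC
  obtain ⟨⟨d, hd⟩, hint⟩ := IsLocalization.exist_integer_multiples_of_finite
    (nonZeroDivisors (Polynomial ℝ)) (fun p : κ × ι => F p.1 p.2)
  choose N hN using hint
  have hd0 : C d ≠ 0 := RatFunc.algebraMap_ne_zero (nonZeroDivisors.ne_zero hd)
  obtain ⟨k, a, B, B', Q, Q', hBQ, hB, hQ⟩ :=
    exists_smith_factorization (Matrix.of fun i j => N (i, j))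
  -- The quotients `a i / d` need not be reduced; Bézout is applied to their reduced numerators and
  -- denominators.
  set f : Fin k → RatFunc ℝ := fun i => C (a i) / C d with hf
  have hbez := fun i => exists_bezout_ne_zero (RatFunc.isCoprime_num_denom (f i))
  choose x y hxy hx0 hx using hbez
  have hxne : ∀ i, C (x i) ≠ 0 := fun i => RatFunc.algebraMap_ne_zero fun h => hx0 i (by simp [h])
  have hdne : ∀ i, C (f i).denom ≠ 0 := fun i => RatFunc.algebraMap_ne_zero (RatFunc.denom_ne_zero _)
  have hfi : ∀ i, f i * C (f i).denom = C (f i).num := fun i =>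
    (eq_div_iff (hdne i)).mp (RatFunc.num_div_denom (f i)).symm
  have hxy' : ∀ i, C (x i) * C (f i).denom + C (y i) * C (f i).num = 1 := fun i => by
    rw [← map_mul, ← map_mul, ← map_add, hxy, map_one]
  set h : Fin k → RatFunc ℝ := fun i => -C (y i) / C (x i) with hh
  have hhi : ∀ i, h i * C (x i) = -C (y i) := fun i => div_mul_cancel₀ _ (hxne i)
  set b := B.map C
  set b' := B'.map C
  set q := Q.map C
  set q' := Q'.map C
  have hb : b' * b = 1 := by rw [← Matrix.map_mul, hB, Matrix.map_one _ (map_zero C) (map_one C)]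
  have hq : q * q' = 1 := by rw [← Matrix.map_mul, hQ, Matrix.map_one _ (map_zero C) (map_one C)]
  have hF : F = b * Matrix.diagonal f * q := by
    have e1 : b * Matrix.diagonal (fun i => C (a i)) * q =
        (Matrix.of fun i j => N (i, j)).map C := by
      rw [hBQ, Matrix.map_mul, Matrix.map_mul, Matrix.diagonal_map (map_zero C)]
    have e2 : Matrix.diagonal f = (C d)⁻¹ • Matrix.diagonal (fun i => C (a i)) := by
      rw [← Matrix.diagonal_smul]
      congr 1
      ext i
      simp [hf, div_eq_inv_mul]
    rw [e2, Matrix.mul_smul, Matrix.smul_mul, e1]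
    ext i j
    have := hN (i, j)
    simp only [Algebra.smul_def] at this
    simp only [Matrix.smul_apply, Matrix.map_apply, Matrix.of_apply, smul_eq_mul]
    rw [hC, this, ← hC, inv_mul_cancel_left₀ hd0]
  let H := q' * Matrix.diagonal h * b'
  let D : (Fin k → Polynomial ℝ) → Matrix (Fin k) (Fin k) (Polynomial ℝ) := Matrix.diagonal
  -- Since `1 - h f = 1/(x d)`, the scalar closed-loop functions `hf/(1-hf)`, `h/(1-hf)` and
  -- `f/(1-hf)` are the polynomials `-y n`, `-y d` and `x n`.
  refine ⟨H, Matrix.fromBlocks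
    (1 + Q' * D (fun i => -y i * (f i).num) * Q) (Q' * D (fun i => -y i * (f i).denom) * B')
    (B * D (fun i => x i * (f i).num) * Q) (1 + B * D (fun i => -y i * (f i).num) * B'), ?_, ?_⟩
  · intro i j
    simp only [H]
    rw [Matrix.mul_apply]
    refine IsCircleRegular.sum _ _ fun l _ => ?_
    rw [Matrix.mul_diagonal]
    refine ⟨Q' i l * -y l * B' l j, x l, hx0 l, hx l, ?_⟩
    simp only [q', b', Matrix.map_apply, map_mul, map_neg, hh, ← hC]
    ring
  · have hm : ∀ (g : Fin k → Polynomial ℝ), (D g).map C = Matrix.diagonal fun i => C (g i) :=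
      fun g => Matrix.diagonal_map (map_zero C)
    rw [Matrix.fromBlocks_map, Matrix.map_add C (map_add C), Matrix.map_add C (map_add C),
      Matrix.map_one C (map_zero C) (map_one C), Matrix.map_one C (map_zero C) (map_one C)]
    simp only [Matrix.map_mul, hm]
    rw [hF]
    refine loopMatrix_mul_of_diagonal hb hq ?_ ?_ ?_ ?_ <;> ext i <;>
      simp only [Pi.mul_apply, Pi.add_apply, map_mul, map_neg]
    · linear_combination C (f i).num * hhi i
    · linear_combination h i * hxy' i - C (f i).denom * hhi i
    · linear_combination f i * hxy' i - C (x i) * hfi i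
    · linear_combination -C (y i) * hfi i

/-! ### The substitution `z ↦ z⁻¹` and the stabilizing feedback. -/

open Polynomial in
theorem aeval_inv_X_eq {N : ℕ} {p : ℝ[X]} (hp : p.natDegree ≤ N) :
    aeval (RatFunc.X⁻¹ : RatFunc ℝ) p =
      algebraMap _ (RatFunc ℝ) (reflect N p) / algebraMap _ (RatFunc ℝ) (X ^ N : ℝ[X]) := by
  let _ : Invertible (RatFunc.X⁻¹ : RatFunc ℝ) :=
    ⟨RatFunc.X, mul_inv_cancel₀ RatFunc.X_ne_zero, inv_mul_cancel₀ RatFunc.X_ne_zero⟩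
  have h := eval₂_reflect_mul_pow (algebraMap ℝ (RatFunc ℝ)) (RatFunc.X⁻¹ : RatFunc ℝ) N p hp
  have h2 : eval₂ (algebraMap ℝ (RatFunc ℝ)) (RatFunc.X : RatFunc ℝ) (reflect N p) =
      algebraMap _ (RatFunc ℝ) (reflect N p) := RatFunc.aeval_X_left_eq_algebraMap _
  rw [aeval_def, ← h, map_pow, RatFunc.algebraMap_X, div_eq_mul_inv, inv_pow, ← h2]
  rfl

/-- Injectivity lets the substitution extend from polynomials to fractions. -/
theorem aeval_inv_X_injective :
    Function.Injective (Polynomial.aeval (R := ℝ) (RatFunc.X⁻¹ : RatFunc ℝ)) := by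
  rw [injective_iff_map_eq_zero]
  intro p hp
  rw [aeval_inv_X_eq le_rfl, div_eq_zero_iff] at hp
  rcases hp with h | h
  · exact Polynomial.reflect_eq_zero_iff.mp
      ((map_eq_zero_iff _ (RatFunc.algebraMap_injective ℝ)).mp h)
  · exact absurd h (RatFunc.algebraMap_ne_zero (pow_ne_zero _ Polynomial.X_ne_zero))

/-- The substitution `z ↦ z⁻¹`. -/
def reciprocal : RatFunc ℝ →+* RatFunc ℝ :=
  RatFunc.liftRingHom (Polynomial.aeval (RatFunc.X⁻¹ : RatFunc ℝ)).toRingHom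
    (nonZeroDivisors_le_comap_nonZeroDivisors_of_injective _ aeval_inv_X_injective)

theorem reciprocal_algebraMap (p : Polynomial ℝ) :
    reciprocal (algebraMap _ (RatFunc ℝ) p) = Polynomial.aeval (RatFunc.X⁻¹ : RatFunc ℝ) p :=
  RatFunc.liftRingHom_algebraMap _ _ _

theorem reciprocal_reciprocal (f : RatFunc ℝ) : reciprocal (reciprocal f) = f := by
  have hX : reciprocal (RatFunc.X⁻¹ : RatFunc ℝ) = RatFunc.X := by
    rw [map_inv₀, ← RatFunc.algebraMap_X, reciprocal_algebraMap, Polynomial.aeval_X, inv_inv,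
      RatFunc.algebraMap_X]
  have h : ∀ p : Polynomial ℝ, reciprocal (reciprocal (algebraMap _ (RatFunc ℝ) p)) =
      algebraMap _ (RatFunc ℝ) p := by
    intro p
    rw [reciprocal_algebraMap]
    induction p using Polynomial.induction_on' with
    | add p q hp hq => rw [map_add, map_add, map_add, hp, hq]
    | monomial n a =>
      rw [Polynomial.aeval_monomial, map_mul, map_pow, hX, ← Polynomial.C_mul_X_pow_eq_monomial,
        map_mul, map_pow, RatFunc.algebraMap_X]
      congr 1
      have : algebraMap ℝ (RatFunc ℝ) a = algebraMap _ (RatFunc ℝ) (Polynomial.C a) := rfl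
      rw [this, reciprocal_algebraMap, Polynomial.aeval_C, this]
  conv_lhs => rw [← RatFunc.num_div_denom f, map_div₀, map_div₀, h, h]
  exact RatFunc.num_div_denom f

theorem isProper_div {a b : Polynomial ℝ} (hb : b ≠ 0) (h : a.natDegree ≤ b.natDegree) :
    IsProper (algebraMap _ (RatFunc ℝ) a / algebraMap _ (RatFunc ℝ) b) := by
  set f := algebraMap _ (RatFunc ℝ) a / algebraMap _ (RatFunc ℝ) b with hf
  rw [IsProper]
  by_cases ha : a = 0
  · simp [hf, ha]
  have hb' := RatFunc.algebraMap_ne_zero hb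
  have e : f.num * b = a * f.denom := (RatFunc.num_mul_eq_mul_denom_iff hb).mpr hf
  have hn : f.num ≠ 0 := by
    rw [Ne, RatFunc.num_eq_zero_iff, hf, div_eq_zero_iff]
    simp [hb', RatFunc.algebraMap_ne_zero ha]
  have := congrArg Polynomial.natDegree e
  rw [Polynomial.natDegree_mul hn hb, Polynomial.natDegree_mul ha (RatFunc.denom_ne_zero f)] at this
  omega

theorem eval_denom_ne_zero {a b : Polynomial ℝ} {z : ℂ} (h : Polynomial.aeval z b ≠ 0) :
    Polynomial.aeval z
      (algebraMap _ (RatFunc ℝ) a / algebraMap _ (RatFunc ℝ) b : RatFunc ℝ).denom ≠ 0 := by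
  obtain ⟨c, hc⟩ := RatFunc.denom_div_dvd a b
  intro h0
  apply h
  rw [hc, map_mul, h0, zero_mul]

/-- `evalC` uses the reduced fraction; any representation with nonvanishing denominator gives the
same value. -/
theorem evalC_div {a b : Polynomial ℝ} {z : ℂ} (h : Polynomial.aeval z b ≠ 0) :
    evalC (algebraMap _ (RatFunc ℝ) a / algebraMap _ (RatFunc ℝ) b) z =
      Polynomial.aeval z a / Polynomial.aeval z b := by
  have hb : b ≠ 0 := by
    rintro rfl
    simp at h
  have e := (RatFunc.num_mul_eq_mul_denom_iff (p := a) hb).mpr rfl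
  have e' := congrArg (Polynomial.aeval z) e
  simp only [map_mul] at e'
  exact (div_eq_div_iff (eval_denom_ne_zero h) h).mpr e'

-- A polynomial in `z⁻¹` is finite at infinity and has no pole except `0`.
open Polynomial in
theorem isStrictlyStable_reciprocal (p : ℝ[X]) :
    IsStrictlyStable (reciprocal (algebraMap _ (RatFunc ℝ) p)) := by
  rw [reciprocal_algebraMap, aeval_inv_X_eq le_rfl]
  refine ⟨isProper_div (pow_ne_zero _ X_ne_zero) ?_, fun z hz => eval_denom_ne_zero ?_⟩
  · rw [natDegree_X_pow]
    exact reverse_natDegree_le p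
  · rw [map_pow, aeval_X]
    apply pow_ne_zero
    rintro rfl
    norm_num at hz

open Polynomial in
theorem reciprocal_div (a b : ℝ[X]) :
    reciprocal (algebraMap _ (RatFunc ℝ) a / algebraMap _ (RatFunc ℝ) b) =
      algebraMap _ (RatFunc ℝ) (reverse a * X ^ b.natDegree) /
        algebraMap _ (RatFunc ℝ) (reverse b * X ^ a.natDegree) := by
  rw [map_div₀, reciprocal_algebraMap, reciprocal_algebraMap, aeval_inv_X_eq le_rfl,
    aeval_inv_X_eq le_rfl, div_div_div_eq, map_mul, map_mul, mul_comm (algebraMap _ _ (X ^ _))]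
  rfl

-- Finiteness at `0` becomes finiteness at infinity: as `b` does not vanish at `0`, reversal
-- preserves its degree.
open Polynomial in
theorem IsCircleRegular.isProper_reciprocal {f : RatFunc ℝ} (hf : IsCircleRegular f) :
    IsProper (reciprocal f) := by
  obtain ⟨a, b, hb, -, rfl⟩ := hf
  have hb0 : b ≠ 0 := by
    rintro rfl
    simp at hb
  have hr : reverse b ≠ 0 := by simpa using hb0
  have hrd : (reverse b).natDegree = b.natDegree := by
    rw [reverse_natDegree, natTrailingDegree_eq_zero.mpr (Or.inr (by rwa [coeff_zero_eq_eval_zero])),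
      Nat.sub_zero]
  rw [reciprocal_div]
  refine isProper_div (mul_ne_zero hr (pow_ne_zero _ X_ne_zero)) ?_
  rw [natDegree_mul_X_pow _ hr, hrd]
  refine natDegree_mul_le.trans ?_
  rw [natDegree_X_pow, add_comm]
  exact Nat.add_le_add_left (reverse_natDegree_le a) _

open Polynomial in
theorem aeval_reverse_ne_zero {b : ℝ[X]} {z : ℂ} (hz : ‖z‖ = 1) (hb : aeval z b ≠ 0) :
    aeval z b.reverse ≠ 0 := by
  have h := aeval_reflect_mul_conj_pow (le_refl b.natDegree) hz
  intro h0
  change aeval z (reflect b.natDegree b) = 0 at h0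
  rw [h0, zero_mul] at h
  exact hb ((map_eq_zero _).mp h.symm)

open Polynomial in
theorem aeval_denom_reciprocal_ne_zero {f : RatFunc ℝ} {z : ℂ} (hz : ‖z‖ = 1)
    (hf : aeval z f.denom ≠ 0) : aeval z (reciprocal f).denom ≠ 0 := by
  have hz0 : z ≠ 0 := by
    rintro rfl
    simp at hz
  conv => rw [← RatFunc.num_div_denom f]
  rw [reciprocal_div]
  apply eval_denom_ne_zero
  rw [map_mul, map_pow, aeval_X]
  exact mul_ne_zero (aeval_reverse_ne_zero hz hf) (pow_ne_zero _ hz0)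

-- Real coefficients, together with `z⁻¹` being the conjugate of `z` on the circle.
open Polynomial in
theorem evalC_reciprocal {f : RatFunc ℝ} {z : ℂ} (hz : ‖z‖ = 1) (hf : aeval z f.denom ≠ 0) :
    evalC (reciprocal f) z = starRingEnd ℂ (evalC f z) := by
  have hz0 : z ≠ 0 := by
    rintro rfl
    simp at hz
  have hinv : starRingEnd ℂ z = z⁻¹ := (Complex.inv_eq_conj hz).symm
  conv_lhs => rw [← RatFunc.num_div_denom f, reciprocal_div]
  have h1 := aeval_reflect_mul_conj_pow (le_refl f.num.natDegree) hz
  have h2 := aeval_reflect_mul_conj_pow (le_refl f.denom.natDegree) hz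
  have hr := aeval_reverse_ne_zero hz hf
  rw [evalC_div (by
    rw [map_mul, map_pow, aeval_X]
    exact mul_ne_zero hr (pow_ne_zero _ hz0))]
  have e : evalC f z = aeval z f.num / aeval z f.denom := rfl
  rw [e, map_div₀, ← h1, ← h2, hinv]
  simp only [map_mul, map_pow, aeval_X]
  change aeval z (reflect _ _) * _ / (aeval z (reflect _ _) * _) = _
  change aeval z (reflect _ _) ≠ 0 at hr
  simp only [inv_pow]
  field_simp

/-- A circle-regular feedback stabilizes, after the substitution `z ↦ z⁻¹`. -/
theorem exists_stabilizing_feedback {κ ι : Type*} [Fintype κ] [Fintype ι] [DecidableEq κ]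
    [DecidableEq ι] (F : Matrix κ ι (RatFunc ℝ)) :
    ∃ H : Matrix ι κ (RatFunc ℝ), (∀ i j, IsProper (H i j)) ∧
      (∀ i j, ∀ z : ℂ, ‖z‖ = 1 → Polynomial.aeval z (H i j).denom ≠ 0) ∧
      IsInternallyStable F H := by
  -- The feedback is built for `F(z⁻¹)`; as the substitution is an involution, applying it to the
  -- loop identity returns the loop of `F`.
  obtain ⟨H, T, hH, hT⟩ := exists_polynomial_loop_inverse (F.map reciprocal)
  have hT' : loopMatrix F (H.map reciprocal) *
      (T.map (algebraMap _ (RatFunc ℝ))).map reciprocal = 1 := by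
    have h := congrArg (fun M => M.map reciprocal) hT
    simp only [Matrix.map_mul] at h
    rw [Matrix.map_one _ (map_zero _) (map_one _)] at h
    rw [← h]
    congr 1
    rw [loopMatrix, loopMatrix, Matrix.fromBlocks_map, Matrix.map_one _ (map_zero _) (map_one _),
      Matrix.map_one _ (map_zero _) (map_one _)]
    congr 1
    · ext i j
      simp
    · ext i j
      simp [reciprocal_reciprocal]
  refine ⟨H.map reciprocal, fun i j => (hH i j).isProper_reciprocal, fun i j z hz => ?_, ?_, ?_⟩
  · apply aeval_denom_reciprocal_ne_zero hz
    obtain ⟨a, b, -, hb, h⟩ := hH i j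
    rw [h]
    exact eval_denom_ne_zero (hb z hz)
  · exact (Matrix.isUnit_iff_isUnit_det _).mp (.of_mul_eq_one _ hT')
  · intro a b
    rw [Matrix.inv_eq_right_inv hT']
    exact isStrictlyStable_reciprocal _

/-! ### Rational functions and matrices on the unit circle. -/

/-- Lebesgue measure on the arguments of the points of the unit circle. -/
abbrev circMeasure : Measure ℝ := volume.restrict (Set.Ioc (-Real.pi) Real.pi)

theorem norm_circ (θ : ℝ) : ‖circ θ‖ = 1 := by
  rw [circ, mul_comm, Complex.norm_exp_ofReal_mul_I]

theorem circ_ne_zero (θ : ℝ) : circ θ ≠ 0 := Complex.exp_ne_zero _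

theorem continuous_circ : Continuous circ := by
  unfold circ
  fun_prop

theorem conj_circ (θ : ℝ) : starRingEnd ℂ (circ θ) = (circ θ)⁻¹ :=
  (Complex.inv_eq_conj (norm_circ θ)).symm

theorem circ_neg (θ : ℝ) : circ (-θ) = starRingEnd ℂ (circ θ) := by
  rw [conj_circ, circ, circ, ← Complex.exp_neg]
  simp

theorem arg_circ {θ : ℝ} (h : θ ∈ Set.Ioc (-Real.pi) Real.pi) : Complex.arg (circ θ) = θ := by
  have := Complex.arg_mul_cos_add_sin_mul_I one_pos h
  rwa [Complex.ofReal_one, one_mul, ← Complex.exp_mul_I, mul_comm] at this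

theorem injOn_circ : Set.InjOn circ (Set.Ioc (-Real.pi) Real.pi) := fun x hx y hy h => by
  rw [← arg_circ hx, h, arg_circ hy]

/-- `circ` is injective on the half-open interval, so the zeros of `p` come from finitely many
arguments. -/
theorem ae_aeval_circ_ne_zero {p : Polynomial ℝ} (hp : p ≠ 0) :
    ∀ᵐ θ ∂circMeasure, Polynomial.aeval (circ θ) p ≠ 0 := by
  rw [ae_restrict_iff' measurableSet_Ioc, ae_iff]
  have hfin : (Set.Ioc (-Real.pi) Real.pi ∩ circ ⁻¹' (p.rootSet ℂ)).Finite :=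
    Set.Finite.of_finite_image (f := circ)
      ((Polynomial.rootSet_finite p ℂ).subset (by rintro _ ⟨x, hx, rfl⟩; exact hx.2))
      (injOn_circ.mono Set.inter_subset_left)
  refine measure_mono_null (fun θ hθ => ?_) (hfin.measure_zero _)
  simp only [Set.mem_ofPred_eq, Classical.not_imp, not_not] at hθ
  exact ⟨hθ.1, (Polynomial.mem_rootSet).mpr ⟨hp, hθ.2⟩⟩

theorem ae_aeval_denom_ne_zero (f : RatFunc ℝ) :
    ∀ᵐ θ ∂circMeasure, Polynomial.aeval (circ θ) f.denom ≠ 0 :=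
  ae_aeval_circ_ne_zero (RatFunc.denom_ne_zero f)

/-- Evaluation respects sums and products away from the poles; hence the matrix identities below are
stated almost everywhere. -/
theorem ae_matrix_denom_ne_zero {κ ι : Type*} [Finite κ] [Finite ι] (A : Matrix κ ι (RatFunc ℝ)) :
    ∀ᵐ θ ∂circMeasure, ∀ i j, Polynomial.aeval (circ θ) (A i j).denom ≠ 0 := by
  simp only [ae_all_iff]
  exact fun i j => ae_aeval_denom_ne_zero _

instance circMeasure_neBot : (ae circMeasure).NeBot := by
  rw [ae_neBot, Ne, Measure.restrict_eq_zero, Real.volume_Ioc]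
  have := Real.pi_pos
  simp [this]

theorem evalC_sum {α : Type*} (s : Finset α) (f : α → RatFunc ℝ) {z : ℂ}
    (h : ∀ i ∈ s, Polynomial.aeval z (f i).denom ≠ 0) :
    Polynomial.aeval z (∑ i ∈ s, f i).denom ≠ 0 ∧
      evalC (∑ i ∈ s, f i) z = ∑ i ∈ s, evalC (f i) z := by
  classical
  induction s using Finset.induction_on with
  | empty => simp [evalC]
  | insert a s ha ih =>
    obtain ⟨h1, h2⟩ := ih fun i hi => h i (Finset.mem_insert_of_mem hi)
    have h3 := h a (Finset.mem_insert_self a s)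
    rw [Finset.sum_insert ha, Finset.sum_insert ha, ← h2]
    refine ⟨fun h0 => ?_, RatFunc.eval_add _ _ h3 h1⟩
    obtain ⟨c, hc⟩ := RatFunc.denom_add_dvd (f a) (∑ i ∈ s, f i)
    have := congrArg (Polynomial.aeval z) hc
    rw [map_mul, map_mul, h0, zero_mul] at this
    exact mul_ne_zero h3 h1 this

theorem evalC_mul {f g : RatFunc ℝ} {z : ℂ} (hf : Polynomial.aeval z f.denom ≠ 0)
    (hg : Polynomial.aeval z g.denom ≠ 0) :
    Polynomial.aeval z (f * g).denom ≠ 0 ∧ evalC (f * g) z = evalC f z * evalC g z := by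
  refine ⟨fun h0 => ?_, RatFunc.eval_mul _ _ hf hg⟩
  obtain ⟨c, hc⟩ := RatFunc.denom_mul_dvd f g
  have := congrArg (Polynomial.aeval z) hc
  rw [map_mul, map_mul, h0, zero_mul] at this
  exact mul_ne_zero hf hg this

theorem evalCirc_mul {κ ι ν : Type*} [Finite κ] [Fintype ι] [Finite ν]
    (A : Matrix κ ι (RatFunc ℝ)) (B : Matrix ι ν (RatFunc ℝ)) :
    ∀ᵐ θ ∂circMeasure, evalCirc (A * B) θ = evalCirc A θ * evalCirc B θ := by
  filter_upwards [ae_matrix_denom_ne_zero A, ae_matrix_denom_ne_zero B] with θ hA hB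
  ext i j
  simp only [evalCirc, Matrix.of_apply, Matrix.mul_apply]
  rw [(evalC_sum _ _ fun k _ => (evalC_mul (hA i k) (hB k j)).1).2]
  exact Finset.sum_congr rfl fun k _ => (evalC_mul (hA i k) (hB k j)).2

/-- The para-Hermitian conjugate `Φ(z⁻¹)ᵀ` of a rational matrix. -/
def paraConj {κ ι : Type*} (A : Matrix κ ι (RatFunc ℝ)) : Matrix ι κ (RatFunc ℝ) :=
  (A.map reciprocal).transpose

theorem evalCirc_paraConj {κ ι : Type*} [Finite κ] [Finite ι] (A : Matrix κ ι (RatFunc ℝ)) :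
    ∀ᵐ θ ∂circMeasure, evalCirc (paraConj A) θ = (evalCirc A θ).conjTranspose := by
  filter_upwards [ae_matrix_denom_ne_zero A] with θ hA
  ext i j
  exact evalC_reciprocal (norm_circ θ) (hA j i)

/-- Distinct rational functions agree at only finitely many points that are poles of neither. -/
theorem eq_of_ae_evalC_eq {f g : RatFunc ℝ}
    (h : ∀ᵐ θ ∂circMeasure, evalC f (circ θ) = evalC g (circ θ)) : f = g := by
  by_contra hne
  have hp : f.num * g.denom - g.num * f.denom ≠ 0 := by
    intro h0
    apply hne
    rw [sub_eq_zero, RatFunc.num_mul_eq_mul_denom_iff (RatFunc.denom_ne_zero g),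
      RatFunc.num_div_denom] at h0
    exact h0
  have hall := (h.and (ae_aeval_circ_ne_zero hp)).and
    ((ae_aeval_denom_ne_zero f).and (ae_aeval_denom_ne_zero g))
  obtain ⟨θ, ⟨h1, h2⟩, h3, h4⟩ := hall.exists
  apply h2
  rw [map_sub, map_mul, map_mul, sub_eq_zero]
  exact (div_eq_div_iff h3 h4).mp h1

theorem eq_of_ae_evalCirc_eq {κ ι : Type*} {A B : Matrix κ ι (RatFunc ℝ)}
    (h : ∀ᵐ θ ∂circMeasure, evalCirc A θ = evalCirc B θ) : A = B := by
  ext i j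
  refine eq_of_ae_evalC_eq (h.mono fun θ hθ => ?_)
  exact congrFun (congrFun hθ i) j

theorem continuous_aeval_circ (p : Polynomial ℝ) :
    Continuous fun θ : ℝ => Polynomial.aeval (circ θ) p :=
  (Polynomial.continuous_aeval p).comp continuous_circ

theorem measurable_evalC_circ (f : RatFunc ℝ) : Measurable fun θ : ℝ => evalC f (circ θ) :=
  (continuous_aeval_circ f.num).measurable.div (continuous_aeval_circ f.denom).measurable

theorem measurable_evalCirc {κ ι : Type*} (A : Matrix κ ι (RatFunc ℝ)) (i : κ) (j : ι) :
    Measurable fun θ : ℝ => evalCirc A θ i j :=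
  measurable_evalC_circ _

theorem continuousAt_evalC {f : RatFunc ℝ} {z : ℂ} (h : Polynomial.aeval z f.denom ≠ 0) :
    ContinuousAt (evalC f) z :=
  (Polynomial.continuous_aeval f.num).continuousAt.div
    (Polynomial.continuous_aeval f.denom).continuousAt h

theorem bounded_evalC_circ {f : RatFunc ℝ}
    (h : ∀ z : ℂ, ‖z‖ = 1 → Polynomial.aeval z f.denom ≠ 0) :
    ∃ C : ℝ, 0 ≤ C ∧ ∀ θ, ‖evalC f (circ θ)‖ ≤ C := by
  have hc : ContinuousOn (evalC f) (Metric.sphere 0 1) := fun z hz =>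
    (continuousAt_evalC (h z (by simpa using hz))).continuousWithinAt
  obtain ⟨C, hC⟩ := (isCompact_sphere (0 : ℂ) 1).exists_bound_of_continuousOn hc
  refine ⟨C, (norm_nonneg _).trans (hC 1 (by simp)), fun θ => hC _ (by simp [norm_circ])⟩

/-! ### Uniform approximation by finite filters. -/

/-- Density of the span of the Fourier monomials in the continuous functions on the circle. -/
theorem exists_trigonometric_approx {k : ℂ → ℂ} (hk : Continuous k) {ε : ℝ} (hε : 0 < ε) :
    ∃ c : ℤ →₀ ℂ, ∀ θ, ‖k (circ θ) - c.sum fun n a => a * circ θ ^ n‖ < ε := by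
  have : Fact (0 < 2 * Real.pi) := ⟨Real.two_pi_pos⟩
  let K : C(AddCircle (2 * Real.pi), ℂ) :=
    ⟨fun x => k (AddCircle.toCircle x), hk.comp (continuous_subtype_val.comp AddCircle.continuous_toCircle)⟩
  have hK : K ∈ (Submodule.span ℂ (Set.range <| @fourier (2 * Real.pi))).topologicalClosure := by
    rw [span_fourier_closure_eq_top]
    trivial
  rw [← SetLike.mem_coe, Submodule.topologicalClosure_coe, Metric.mem_closure_iff] at hK
  obtain ⟨g, hg, hd⟩ := hK ε hε
  obtain ⟨c, rfl⟩ := (Finsupp.mem_span_range_iff_exists_finsupp).mp hg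
  refine ⟨c, fun θ => ?_⟩
  have h1 : ((AddCircle.toCircle (θ : AddCircle (2 * Real.pi)) : Circle) : ℂ) = circ θ := by
    rw [AddCircle.toCircle_apply_mk, Circle.coe_exp, circ, div_self Real.two_pi_pos.ne', one_mul,
      mul_comm]
  have h2 : ∀ n : ℤ, fourier n (θ : AddCircle (2 * Real.pi)) = circ θ ^ n := fun n => by
    rw [fourier_apply, AddCircle.toCircle_zsmul, Circle.coe_zpow, h1]
  have h3 := (ContinuousMap.dist_lt_iff hε).mp hd (θ : AddCircle (2 * Real.pi))
  rw [dist_eq_norm] at h3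
  have e : k (circ θ) - (c.sum fun n a => a * circ θ ^ n) =
      K (θ : AddCircle (2 * Real.pi)) -
        (c.sum fun n a => a • fourier n : C(AddCircle (2 * Real.pi), ℂ)) θ := by
    refine congrArg₂ (fun a b : ℂ => a - b) ?_ ?_
    · change _ = k _
      rw [h1]
    · rw [Finsupp.sum, Finsupp.sum, ContinuousMap.sum_apply]
      refine Finset.sum_congr rfl fun n _ => ?_
      rw [ContinuousMap.smul_apply, h2, smul_eq_mul]
  rw [e]
  exact h3

theorem finTransfer_eq_sum {ι : Type*} {c : ℤ →₀ (ι → ℝ)} {S : Finset ℤ} (h : c.support ⊆ S)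
    (θ : ℝ) (i : ι) : finTransfer c θ i = ∑ k ∈ S, (c k i : ℂ) * circ θ ^ k :=
  Finsupp.sum_of_support_subset _ h _ fun _ _ => by simp

/-- Functions on the circle with the symmetry of real transfer functions are uniform limits of
transfer functions of finite filters. -/
theorem exists_finTransfer_approx {ι : Type*} [Fintype ι] {k : ι → ℂ → ℂ}
    (hk : ∀ i, Continuous (k i)) (hreal : ∀ i z, k i (starRingEnd ℂ z) = starRingEnd ℂ (k i z))
    {ε : ℝ} (hε : 0 < ε) :
    ∃ c : ℤ →₀ (ι → ℝ), ∀ θ i, ‖k i (circ θ) - finTransfer c θ i‖ < ε := by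
  classical
  choose d hd using fun i => exists_trigonometric_approx (hk i) hε
  let S : Finset ℤ := Finset.univ.biUnion fun i => (d i).support
  -- Taking real parts of the coefficients averages the approximant at `θ` with the conjugate of the
  -- approximant at `-θ`. By the symmetry of `k`, both lie within `ε`.
  let c : ℤ →₀ (ι → ℝ) := Finsupp.onFinset S (fun n i => (d i n).re) fun n hn => by
    obtain ⟨i, hi⟩ := Function.ne_iff.mp hn
    refine Finset.mem_biUnion.mpr ⟨i, Finset.mem_univ i, Finsupp.mem_support_iff.mpr fun h0 => ?_⟩
    simp [h0] at hi
  refine ⟨c, fun θ i => ?_⟩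
  have hsum : ∀ t, ((d i).sum fun n a => a * circ t ^ n) = ∑ n ∈ S, d i n * circ t ^ n := fun t =>
    Finsupp.sum_of_support_subset _ (Finset.subset_biUnion_of_mem (fun i => (d i).support)
      (Finset.mem_univ i)) _ fun _ _ => by simp
  have h1 := hd i θ
  have h2 := hd i (-θ)
  rw [circ_neg, hreal, ← circ_neg, hsum, ← Complex.norm_conj, map_sub, Complex.conj_conj] at h2
  rw [hsum] at h1
  have key : k i (circ θ) - finTransfer c θ i =
      (1 / 2 : ℂ) * ((k i (circ θ) - ∑ n ∈ S, d i n * circ θ ^ n) +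
        (k i (circ θ) - starRingEnd ℂ (∑ n ∈ S, d i n * circ (-θ) ^ n))) := by
    have hc : finTransfer c θ i = (1 / 2 : ℂ) * (∑ n ∈ S, d i n * circ θ ^ n +
        starRingEnd ℂ (∑ n ∈ S, d i n * circ (-θ) ^ n)) := by
      rw [finTransfer_eq_sum Finsupp.support_onFinset_subset, map_sum, ← Finset.sum_add_distrib,
        Finset.mul_sum]
      refine Finset.sum_congr rfl fun n _ => ?_
      rw [map_mul, map_zpow₀, circ_neg, Complex.conj_conj]
      have : ((c n i : ℝ) : ℂ) = (d i n + starRingEnd ℂ (d i n)) / 2 :=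
        Complex.re_eq_add_conj (d i n)
      rw [this]
      ring
    rw [hc]
    ring
  rw [key, norm_mul]
  have := norm_add_le (k i (circ θ) - ∑ n ∈ S, d i n * circ θ ^ n)
    (k i (circ θ) - starRingEnd ℂ (∑ n ∈ S, d i n * circ (-θ) ^ n))
  rw [show ‖(1 / 2 : ℂ)‖ = 1 / 2 by norm_num]
  linarith

/-! ### Positive semidefinite sesquilinear forms. -/

/-- The sesquilinear form `v M w^*` of a complex matrix. -/
def sesq {ι : Type*} [Fintype ι] (M : Matrix ι ι ℂ) (v w : ι → ℂ) : ℂ :=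
  v ⬝ᵥ Matrix.mulVec M (star w)

section Sesq

variable {ι : Type*} [Fintype ι] (M : Matrix ι ι ℂ)

theorem sesq_eq_sum (v w : ι → ℂ) :
    sesq M v w = ∑ i, ∑ j, v i * M i j * starRingEnd ℂ (w j) := by
  simp only [sesq, dotProduct, Matrix.mulVec, Finset.mul_sum, Pi.star_apply, mul_assoc]
  rfl

theorem sesq_add_left (v v' w : ι → ℂ) : sesq M (v + v') w = sesq M v w + sesq M v' w :=
  add_dotProduct _ _ _

theorem sesq_sub_left (v v' w : ι → ℂ) : sesq M (v - v') w = sesq M v w - sesq M v' w :=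
  sub_dotProduct _ _ _

theorem sesq_smul_left (c : ℂ) (v w : ι → ℂ) : sesq M (c • v) w = c * sesq M v w :=
  smul_dotProduct _ _ _

theorem sesq_add_right (v w w' : ι → ℂ) : sesq M v (w + w') = sesq M v w + sesq M v w' := by
  simp only [sesq, star_add, Matrix.mulVec_add, dotProduct_add]

theorem sesq_sub_right (v w w' : ι → ℂ) : sesq M v (w - w') = sesq M v w - sesq M v w' := by
  simp only [sesq, star_sub, Matrix.mulVec_sub, dotProduct_sub]

theorem sesq_smul_right (c : ℂ) (v w : ι → ℂ) :
    sesq M v (c • w) = starRingEnd ℂ c * sesq M v w := by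
  simp only [sesq, star_smul, Matrix.mulVec_smul, dotProduct_smul, smul_eq_mul]
  rfl

/-- `v M v^*` is real and nonnegative for all `v`. -/
def IsNonneg : Prop := ∀ v, 0 ≤ (sesq M v v).re ∧ (sesq M v v).im = 0

variable {M}

/-- Polarization: the form is real at `v + w` and at `v + i w`. -/
theorem IsNonneg.conj_sesq (h : IsNonneg M) (v w : ι → ℂ) :
    starRingEnd ℂ (sesq M v w) = sesq M w v := by
  have h1 := (h (v + w)).2
  have h2 := (h (v + Complex.I • w)).2
  have hv := (h v).2
  have hw := (h w).2
  simp only [sesq_add_left, sesq_add_right, sesq_smul_left, sesq_smul_right, Complex.add_im,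
    Complex.add_re, Complex.mul_im, Complex.mul_re, Complex.conj_re, Complex.conj_im, Complex.I_re, Complex.I_im,
    hv, hw] at h1 h2
  apply Complex.ext <;> simp only [Complex.conj_re, Complex.conj_im] <;> linarith

theorem IsNonneg.re_sesq_add_le (h : IsNonneg M) (v w : ι → ℂ) :
    (sesq M (v + w) (v + w)).re ≤ 2 * (sesq M v v).re + 2 * (sesq M w w).re := by
  have h1 := (h (v - w)).1
  simp only [sesq_add_left, sesq_add_right, sesq_sub_left, sesq_sub_right, Complex.add_re,
    Complex.sub_re] at h1 ⊢
  linarith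

/-- Cauchy–Schwarz: with `s = sesq M v w`, the form at `v + t s w` is a nonnegative real quadratic
in `t`, so its discriminant is not positive. -/
theorem IsNonneg.norm_sesq_sq_le (h : IsNonneg M) (v w : ι → ℂ) :
    ‖sesq M v w‖ ^ 2 ≤ (sesq M v v).re * (sesq M w w).re := by
  set s := sesq M v w with hs
  have hsw : sesq M w v = starRingEnd ℂ s := (h.conj_sesq v w).symm
  have key : ∀ t : ℝ, 0 ≤ ‖s‖ ^ 2 * (sesq M w w).re * (t * t) + (2 * ‖s‖ ^ 2) * t +
      (sesq M v v).re := fun t => by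
    have h1 := (h (v + ((t : ℂ) * s) • w)).1
    have e : sesq M (v + ((t : ℂ) * s) • w) (v + ((t : ℂ) * s) • w) =
        sesq M v v + (2 * t : ℝ) * (s * starRingEnd ℂ s) +
          (t * t : ℝ) * (s * starRingEnd ℂ s) * sesq M w w := by
      simp only [sesq_add_left, sesq_add_right, sesq_smul_left, sesq_smul_right, hsw, ← hs,
        map_mul, Complex.conj_ofReal]
      push_cast
      ring
    rw [e, Complex.mul_conj, Complex.normSq_eq_norm_sq, ← Complex.ofReal_mul, ← Complex.ofReal_mul,
      Complex.add_re, Complex.add_re, Complex.re_ofReal_mul, Complex.ofReal_re] at h1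
    linarith
  have hd := discrim_le_zero key
  rw [discrim] at hd
  rcases eq_or_ne ‖s‖ 0 with h0 | h0
  · rw [h0]
    have := mul_nonneg (h v).1 (h w).1
    simpa using this
  · have hp : 0 < ‖s‖ ^ 2 := by positivity
    have : ‖s‖ ^ 2 * (‖s‖ ^ 2 - (sesq M v v).re * (sesq M w w).re) ≤ 0 := by linarith
    nlinarith

/-- By Cauchy–Schwarz a null vector pairs to zero with every vector, so it is in the left kernel of
`M`. -/
theorem IsNonneg.eq_zero_of_re_sesq_eq_zero [DecidableEq ι] (h : IsNonneg M) (hM : M.det ≠ 0)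
    {v : ι → ℂ} (hv : (sesq M v v).re = 0) : v = 0 := by
  have h0 : ∀ w, sesq M v w = 0 := fun w => by
    have := h.norm_sesq_sq_le v w
    rw [hv, zero_mul] at this
    have h2 : ‖sesq M v w‖ ^ 2 = 0 := le_antisymm this (by positivity)
    simpa using h2
  have h1 : Matrix.vecMul v M = 0 := by
    ext j
    have := h0 (Pi.single j 1)
    rw [sesq, Matrix.dotProduct_mulVec] at this
    simpa using this
  exact Matrix.eq_zero_of_vecMul_eq_zero hM h1

theorem norm_sesq_le (M : Matrix ι ι ℂ) {v w : ι → ℂ} {a b : ℝ} (ha : 0 ≤ a) (hv : ∀ i, ‖v i‖ ≤ a)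
    (hw : ∀ i, ‖w i‖ ≤ b) : ‖sesq M v w‖ ≤ a * b * ∑ i, ∑ j, ‖M i j‖ := by
  rw [sesq_eq_sum, Finset.mul_sum]
  refine (norm_sum_le _ _).trans (Finset.sum_le_sum fun i _ => ?_)
  rw [Finset.mul_sum]
  refine (norm_sum_le _ _).trans (Finset.sum_le_sum fun j _ => ?_)
  rw [norm_mul, norm_mul, Complex.norm_conj]
  calc ‖v i‖ * ‖M i j‖ * ‖w j‖ ≤ a * ‖M i j‖ * b := by
        gcongr
        · exact hv i
        · exact hw j
    _ = a * b * ‖M i j‖ := by ring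

end Sesq

/-! ### Covariances of finite filters in the frequency domain. -/

theorem finOutput_eq_sum {Ω ι : Type*} [Fintype ι] (c : ℤ →₀ (ι → ℝ)) (x : ℤ → Ω → ι → ℝ) (t : ℤ) (ω : Ω) :
    finOutput c x t ω = ∑ p ∈ c.support ×ˢ Finset.univ, c p.1 p.2 * x (t + p.1) ω p.2 := by
  rw [Finset.sum_product]
  rfl

section Isometry

variable {Ω : Type*} [MeasurableSpace Ω] {P : Measure Ω} {ι : Type*}
  {x : ℤ → Ω → ι → ℝ} {Φ : Matrix ι ι (RatFunc ℝ)}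

theorem HasSpectralDensity.integral_mul (h : HasSpectralDensity P x Φ) (t s : ℤ) (i j : ι) :
    ((∫ ω, x t ω i * x s ω j ∂P : ℝ) : ℂ) =
      (1 / (2 * Real.pi) : ℂ) * ∫ θ, circ θ ^ (t - s) * evalCirc Φ θ i j ∂circMeasure := by
  rw [← h.covariance_eq, ← h.stationary.covariance s, add_sub_cancel]

theorem HasSpectralDensity.integrable_zpow_mul (h : HasSpectralDensity P x Φ) (k : ℤ) (i j : ι) :
    Integrable (fun θ => circ θ ^ k * evalCirc Φ θ i j) circMeasure := by
  refine (h.integrable i j).bdd_mul (c := 1) ?_ ?_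
  · exact (continuous_circ.zpow₀ k fun θ => Or.inl (circ_ne_zero θ)).aestronglyMeasurable
  · refine Filter.Eventually.of_forall fun θ => ?_
    rw [norm_zpow, norm_circ, one_zpow]

variable [Fintype ι]

theorem sesq_finTransfer (M : Matrix ι ι ℂ) (c d : ℤ →₀ (ι → ℝ)) (θ : ℝ) :
    sesq M (finTransfer c θ) (finTransfer d θ) =
      ∑ p ∈ c.support ×ˢ Finset.univ, ∑ q ∈ d.support ×ˢ Finset.univ,
        (c p.1 p.2 * d q.1 q.2 : ℝ) * (circ θ ^ (p.1 - q.1) * M p.2 q.2) := by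
  rw [sesq_eq_sum]
  simp only [Finset.sum_product_right]
  refine Finset.sum_congr rfl fun i _ => ?_
  rw [Finset.sum_comm]
  refine Finset.sum_congr rfl fun j _ => ?_
  simp only [finTransfer, Finsupp.sum, map_sum, Finset.sum_mul, Finset.mul_sum]
  rw [Finset.sum_comm]
  refine Finset.sum_congr rfl fun k _ => Finset.sum_congr rfl fun l _ => ?_
  rw [zpow_sub₀ (circ_ne_zero θ), map_mul, map_zpow₀, conj_circ, Complex.conj_ofReal, inv_zpow]
  push_cast
  ring

theorem HasSpectralDensity.memLp_finOutput (h : HasSpectralDensity P x Φ) (c : ℤ →₀ (ι → ℝ))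
    (t : ℤ) : MemLp (finOutput c x t) 2 P := by
  have : finOutput c x t = ∑ p ∈ c.support ×ˢ Finset.univ, fun ω => c p.1 p.2 * x (t + p.1) ω p.2 := by
    ext ω
    rw [finOutput_eq_sum, Finset.sum_apply]
  rw [this]
  exact memLp_finsetSum' _ fun p _ => (h.stationary.memLp _ _).const_mul _

/-- The covariances of outputs of finite filters, in the frequency domain. -/
theorem HasSpectralDensity.integral_finOutput_mul (h : HasSpectralDensity P x Φ)
    (c d : ℤ →₀ (ι → ℝ)) (t s : ℤ) :
    ((∫ ω, finOutput c x t ω * finOutput d x s ω ∂P : ℝ) : ℂ) =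
      (1 / (2 * Real.pi) : ℂ) * ∫ θ, circ θ ^ (t - s) *
        sesq (evalCirc Φ θ) (finTransfer c θ) (finTransfer d θ) ∂circMeasure := by
  have h1 : ∀ ω, finOutput c x t ω * finOutput d x s ω =
      ∑ p ∈ c.support ×ˢ Finset.univ, ∑ q ∈ d.support ×ˢ Finset.univ,
        (c p.1 p.2 * d q.1 q.2) * (x (t + p.1) ω p.2 * x (s + q.1) ω q.2) := fun ω => by
    rw [finOutput_eq_sum, finOutput_eq_sum, Finset.sum_mul_sum]
    refine Finset.sum_congr rfl fun p _ => Finset.sum_congr rfl fun q _ => by ring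
  have h2 : ∀ θ, circ θ ^ (t - s) * sesq (evalCirc Φ θ) (finTransfer c θ) (finTransfer d θ) =
      ∑ p ∈ c.support ×ˢ Finset.univ, ∑ q ∈ d.support ×ˢ Finset.univ,
        ((c p.1 p.2 * d q.1 q.2 : ℝ) : ℂ) *
          (circ θ ^ ((t + p.1) - (s + q.1)) * evalCirc Φ θ p.2 q.2) := fun θ => by
    rw [sesq_finTransfer, Finset.mul_sum]
    refine Finset.sum_congr rfl fun p _ => ?_
    rw [Finset.mul_sum]
    refine Finset.sum_congr rfl fun q _ => ?_
    rw [add_sub_add_comm, zpow_add₀ (circ_ne_zero θ)]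
    ring
  simp only [h1, h2]
  have i1 : ∀ (a b : ℤ) i j, Integrable (fun ω => x a ω i * x b ω j) P := fun a b i j =>
    (h.stationary.memLp a i).integrable_mul (h.stationary.memLp b j)
  rw [integral_finsetSum _ fun p _ => integrable_finsetSum _ fun q _ => (i1 _ _ _ _).const_mul _,
    integral_finsetSum _ fun p _ => integrable_finsetSum _ fun q _ =>
      (h.integrable_zpow_mul _ _ _).const_mul _, Complex.ofReal_sum, Finset.mul_sum]
  refine Finset.sum_congr rfl fun p _ => ?_
  rw [integral_finsetSum _ fun q _ => (i1 _ _ _ _).const_mul _,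
    integral_finsetSum _ fun q _ => (h.integrable_zpow_mul _ _ _).const_mul _,
    Complex.ofReal_sum, Finset.mul_sum]
  refine Finset.sum_congr rfl fun q _ => ?_
  rw [integral_const_mul, integral_const_mul, Complex.ofReal_mul, h.integral_mul]
  ring

end Isometry

/-! ### Positivity of spectral densities. -/

/-- Positivity against squares of continuous functions on the circle gives pointwise positivity. -/
theorem nonneg_of_integral_sq_mul_nonneg {g : ℂ → ℝ} {θ₀ : ℝ}
    (hθ : θ₀ ∈ Set.Ioo (-Real.pi) Real.pi) (hg : ContinuousAt g (circ θ₀))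
    (hint : Integrable (fun θ => g (circ θ)) circMeasure)
    (h : ∀ k : ℂ → ℝ, Continuous k → 0 ≤ ∫ θ, k (circ θ) ^ 2 * g (circ θ) ∂circMeasure) :
    0 ≤ g (circ θ₀) := by
  by_contra! hneg
  obtain ⟨δ, hδ, hball⟩ := Metric.eventually_nhds_iff.mp (hg.eventually_lt_const hneg)
  -- A tent function supported where `g` is negative: the integral against its square would have to
  -- be strictly negative.
  set k : ℂ → ℝ := fun z => max 0 (δ - dist z (circ θ₀)) with hk
  have hkc : Continuous k := by
    simp only [hk]
    fun_prop
  have hk0 : ∀ z, 0 ≤ k z := fun z => le_max_left _ _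
  have hkδ : ∀ z, k z ≤ δ := fun z => max_le hδ.le (by linarith [dist_nonneg (x := z) (y := circ θ₀)])
  have hf0 : ∀ θ, 0 ≤ -(k (circ θ) ^ 2 * g (circ θ)) := fun θ => by
    by_cases hd : dist (circ θ) (circ θ₀) < δ
    · have := hball hd
      nlinarith [sq_nonneg (k (circ θ))]
    · have : k (circ θ) = 0 := max_eq_left (by linarith)
      rw [this]
      simp
  have hfi : Integrable (fun θ => -(k (circ θ) ^ 2 * g (circ θ))) circMeasure := by
    refine (hint.bdd_mul (c := δ ^ 2) ?_ ?_).neg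
    · exact ((hkc.comp continuous_circ).pow 2).aestronglyMeasurable
    · refine Filter.Eventually.of_forall fun θ => ?_
      rw [norm_pow, Real.norm_of_nonneg (hk0 _)]
      exact pow_le_pow_left₀ (hk0 _) (hkδ _) 2
  have hz : ∫ θ, -(k (circ θ) ^ 2 * g (circ θ)) ∂circMeasure = 0 := by
    apply le_antisymm
    · rw [integral_neg]
      linarith [h k hkc]
    · exact integral_nonneg hf0
  have hae := (integral_eq_zero_iff_of_nonneg hf0 hfi).mp hz
  have hU : IsOpen (Set.Ioo (-Real.pi) Real.pi ∩ circ ⁻¹' Metric.ball (circ θ₀) δ) :=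
    isOpen_Ioo.inter (Metric.isOpen_ball.preimage continuous_circ)
  have hpos := hU.measure_pos volume ⟨θ₀, hθ, Metric.mem_ball_self hδ⟩
  refine hpos.ne' (measure_mono_null ?_
    ((ae_restrict_iff' measurableSet_Ioc).mp hae : volume _ = 0))
  rintro θ ⟨h1, h2⟩ h3
  have h4 := h3 (Set.Ioo_subset_Ioc_self h1)
  simp only [Pi.zero_apply, neg_eq_zero, mul_eq_zero, pow_eq_zero_iff, ne_eq, OfNat.ofNat_ne_zero,
    not_false_eq_true] at h4
  rcases h4 with h4 | h4
  · have : 0 < k (circ θ) := lt_max_of_lt_right (sub_pos.mpr h2)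
    exact this.ne' h4
  · exact (hball h2).ne h4

theorem continuous_finTransfer {ι : Type*} (c : ℤ →₀ (ι → ℝ)) (i : ι) :
    Continuous fun θ => finTransfer c θ i :=
  continuous_finsetSum _ fun k _ => continuous_const.mul
    (continuous_circ.zpow₀ k fun θ => Or.inl (circ_ne_zero θ))

theorem tendsto_integral_norm_sq_mul {p : ℕ → ℝ → ℂ} {k : ℝ → ℝ} {f : ℝ → ℂ} {C : ℝ}
    (hf : Integrable f circMeasure) (hpc : ∀ n, Continuous (p n)) (hpb : ∀ n θ, ‖p n θ‖ ≤ C)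
    (hp : ∀ θ, Filter.Tendsto (fun n => p n θ) Filter.atTop (nhds (k θ : ℂ))) :
    Filter.Tendsto (fun n => ∫ θ, ((‖p n θ‖ ^ 2 : ℝ) : ℂ) * f θ ∂circMeasure) Filter.atTop
      (nhds (∫ θ, ((k θ ^ 2 : ℝ) : ℂ) * f θ ∂circMeasure)) := by
  refine tendsto_integral_of_dominated_convergence (fun θ => C ^ 2 * ‖f θ‖)
    (fun n => ?_) (hf.norm.const_mul _) (fun n => ?_) ?_
  · exact (Complex.continuous_ofReal.comp ((hpc n).norm.pow 2)).aestronglyMeasurable.mul hf.1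
  · refine Filter.Eventually.of_forall fun θ => ?_
    rw [norm_mul, Complex.norm_real, norm_pow, norm_norm]
    gcongr
    exact hpb n θ
  · refine Filter.Eventually.of_forall fun θ => ?_
    refine Filter.Tendsto.mul_const _ ((Complex.continuous_ofReal.tendsto _).comp ?_)
    have := ((hp θ).norm).pow 2
    rwa [Complex.norm_real, Real.norm_eq_abs, sq_abs] at this

section Nonneg

variable {Ω : Type*} [MeasurableSpace Ω] {P : Measure Ω} {ι : Type*} [Fintype ι]
  {x : ℤ → Ω → ι → ℝ} {Φ : Matrix ι ι (RatFunc ℝ)}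

theorem HasSpectralDensity.integrable_sesq (h : HasSpectralDensity P x Φ) {a b : ℝ → ι → ℂ}
    (ha : ∀ i, Measurable fun θ => a θ i) (hb : ∀ i, Measurable fun θ => b θ i) {A B : ℝ}
    (hA : ∀ θ i, ‖a θ i‖ ≤ A) (hB : ∀ θ i, ‖b θ i‖ ≤ B) :
    Integrable (fun θ => sesq (evalCirc Φ θ) (a θ) (b θ)) circMeasure := by
  simp only [sesq_eq_sum]
  refine integrable_finsetSum _ fun i _ => integrable_finsetSum _ fun j _ => ?_
  have h1 : Integrable (fun θ => a θ i * evalCirc Φ θ i j) circMeasure :=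
    Integrable.bdd_mul (h.integrable i j) (ha i).aestronglyMeasurable
      (Filter.Eventually.of_forall fun θ => hA θ i)
  refine h1.mul_bdd (c := B) ?_ (Filter.Eventually.of_forall fun θ => ?_)
  · exact (Complex.continuous_conj.measurable.comp (hb j)).aestronglyMeasurable
  · rw [Complex.norm_conj]
    exact hB θ j

theorem HasSpectralDensity.integrable_sesq_const (h : HasSpectralDensity P x Φ) (v : ι → ℂ) :
    Integrable (fun θ => sesq (evalCirc Φ θ) v v) circMeasure :=
  have hle : ∀ i, ‖v i‖ ≤ ∑ i, ‖v i‖ := fun i =>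
    Finset.single_le_sum (f := fun i => ‖v i‖) (fun _ _ => norm_nonneg _) (Finset.mem_univ i)
  h.integrable_sesq (fun _ => measurable_const) (fun _ => measurable_const)
    (fun _ => hle) (fun _ => hle)

theorem exists_norm_finTransfer_le (c : ℤ →₀ (ι → ℝ)) :
    ∃ A : ℝ, 0 ≤ A ∧ ∀ θ i, ‖finTransfer c θ i‖ ≤ A := by
  refine ⟨∑ k ∈ c.support, ∑ i, |c k i|, by positivity, fun θ i => ?_⟩
  refine (norm_sum_le _ _).trans (Finset.sum_le_sum fun k _ => ?_)
  rw [norm_mul, norm_zpow, norm_circ, one_zpow, mul_one, Complex.norm_real, Real.norm_eq_abs]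
  exact Finset.single_le_sum (f := fun i => |c k i|) (fun i _ => abs_nonneg _) (Finset.mem_univ i)

theorem HasSpectralDensity.integrable_sesq_finTransfer (h : HasSpectralDensity P x Φ)
    (c d : ℤ →₀ (ι → ℝ)) :
    Integrable (fun θ => sesq (evalCirc Φ θ) (finTransfer c θ) (finTransfer d θ)) circMeasure := by
  obtain ⟨A, -, hA⟩ := exists_norm_finTransfer_le c
  obtain ⟨B, -, hB⟩ := exists_norm_finTransfer_le d
  exact h.integrable_sesq (fun i => (continuous_finTransfer c i).measurable)
    (fun i => (continuous_finTransfer d i).measurable) hA hB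

theorem HasSpectralDensity.integral_sesq_finTransfer (h : HasSpectralDensity P x Φ)
    (c d : ℤ →₀ (ι → ℝ)) :
    ∫ θ, sesq (evalCirc Φ θ) (finTransfer c θ) (finTransfer d θ) ∂circMeasure =
      ((2 * Real.pi * ∫ ω, finOutput c x 0 ω * finOutput d x 0 ω ∂P : ℝ) : ℂ) := by
  have := h.integral_finOutput_mul c d 0 0
  simp only [sub_self, zpow_zero, one_mul] at this
  rw [Complex.ofReal_mul, this]
  have hpi : (Real.pi : ℂ) ≠ 0 := by exact_mod_cast Real.pi_ne_zero
  push_cast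
  field_simp

/-- The energy of a filter with complex coefficients is the sum of those of its real and imaginary
parts. The cross terms cancel because covariances of real outputs are symmetric; Hermitian symmetry
of `Φ` is not yet available. -/
theorem HasSpectralDensity.integral_sesq_complex (h : HasSpectralDensity P x Φ)
    (c d : ℤ →₀ (ι → ℝ)) {G : ℝ → ι → ℂ}
    (hG : ∀ θ, G θ = finTransfer c θ + Complex.I • finTransfer d θ) :
    ∃ r : ℝ, 0 ≤ r ∧ ∫ θ, sesq (evalCirc Φ θ) (G θ) (G θ) ∂circMeasure = r := by
  refine ⟨2 * Real.pi * (∫ ω, finOutput c x 0 ω * finOutput c x 0 ω ∂P) +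
    2 * Real.pi * (∫ ω, finOutput d x 0 ω * finOutput d x 0 ω ∂P), ?_, ?_⟩
  · have h1 : ∀ c : ℤ →₀ (ι → ℝ), 0 ≤ ∫ ω, finOutput c x 0 ω * finOutput c x 0 ω ∂P := fun c =>
      integral_nonneg fun ω => mul_self_nonneg _
    have h2 := h1 c
    have h3 := h1 d
    have := Real.pi_pos
    positivity
  · have e : ∀ θ, sesq (evalCirc Φ θ) (G θ) (G θ) =
        (sesq (evalCirc Φ θ) (finTransfer c θ) (finTransfer c θ) +
          sesq (evalCirc Φ θ) (finTransfer d θ) (finTransfer d θ)) +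
        (Complex.I * sesq (evalCirc Φ θ) (finTransfer d θ) (finTransfer c θ) -
          Complex.I * sesq (evalCirc Φ θ) (finTransfer c θ) (finTransfer d θ)) := fun θ => by
      simp only [hG, sesq_add_left, sesq_add_right, sesq_smul_left, sesq_smul_right, Complex.conj_I]
      linear_combination -sesq (evalCirc Φ θ) (finTransfer d θ) (finTransfer d θ) * Complex.I_mul_I
    have hi := h.integrable_sesq_finTransfer
    simp only [e]
    refine (integral_add ((hi c c).add (hi d d))
      (((hi d c).const_mul Complex.I).sub ((hi c d).const_mul Complex.I))).trans ?_
    refine (congrArg₂ (· + ·) (integral_add (hi c c) (hi d d))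
      (integral_sub ((hi d c).const_mul Complex.I) ((hi c d).const_mul Complex.I))).trans ?_
    rw [integral_const_mul, integral_const_mul]
    simp only [h.integral_sesq_finTransfer]
    have : ∫ ω, finOutput d x 0 ω * finOutput c x 0 ω ∂P =
        ∫ ω, finOutput c x 0 ω * finOutput d x 0 ω ∂P := by
      simp only [mul_comm]
    rw [this, sub_self, add_zero]
    push_cast
    ring

/-- A trigonometric polynomial times a constant vector is the transfer function of a complex finite
filter. -/
theorem HasSpectralDensity.integral_trigonometric_sesq (h : HasSpectralDensity P x Φ)
    (a : ℤ →₀ ℂ) (v : ι → ℂ) :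
    ∃ r : ℝ, 0 ≤ r ∧ ∫ θ, ((‖a.sum fun n b => b * circ θ ^ n‖ ^ 2 : ℝ) : ℂ) *
      sesq (evalCirc Φ θ) v v ∂circMeasure = r := by
  let c : ℤ →₀ (ι → ℝ) := a.mapRange (fun b i => (b * v i).re) (by ext; simp)
  let d : ℤ →₀ (ι → ℝ) := a.mapRange (fun b i => (b * v i).im) (by ext; simp)
  obtain ⟨r, hr, hi⟩ := h.integral_sesq_complex c d
    (G := fun θ => (a.sum fun n b => b * circ θ ^ n) • v) (fun θ => by
      ext i
      simp only [Pi.add_apply, Pi.smul_apply, smul_eq_mul]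
      rw [finTransfer_eq_sum (S := a.support) Finsupp.support_mapRange,
        finTransfer_eq_sum (S := a.support) Finsupp.support_mapRange, Finsupp.sum, Finset.sum_mul,
        Finset.mul_sum, ← Finset.sum_add_distrib]
      refine Finset.sum_congr rfl fun n _ => ?_
      have : a n * v i = ((a n * v i).re : ℂ) + (a n * v i).im * Complex.I :=
        (Complex.re_add_im _).symm
      simp only [Finsupp.mapRange_apply]
      linear_combination circ θ ^ n * this)
  refine ⟨r, hr, ?_⟩
  rw [← hi]
  refine integral_congr_ae (Filter.Eventually.of_forall fun θ => ?_)
  simp only [sesq_smul_left, sesq_smul_right]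
  rw [← mul_assoc, mul_comm (starRingEnd ℂ _), Complex.mul_conj, Complex.normSq_eq_norm_sq]

theorem HasSpectralDensity.integral_sq_mul_sesq (h : HasSpectralDensity P x Φ) {k : ℂ → ℝ}
    (hk : Continuous k) (v : ι → ℂ) :
    0 ≤ (∫ θ, ((k (circ θ) ^ 2 : ℝ) : ℂ) * sesq (evalCirc Φ θ) v v ∂circMeasure).re ∧
      (∫ θ, ((k (circ θ) ^ 2 : ℝ) : ℂ) * sesq (evalCirc Φ θ) v v ∂circMeasure).im = 0 := by
  obtain ⟨K, hK⟩ := (isCompact_sphere (0 : ℂ) 1).exists_bound_of_continuousOn hk.continuousOn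
  have hK' : ∀ θ, ‖k (circ θ)‖ ≤ K := fun θ => hK _ (by simp [norm_circ])
  choose a ha using fun n : ℕ => exists_trigonometric_approx (k := fun z => (k z : ℂ))
    (Complex.continuous_ofReal.comp hk) (Nat.one_div_pos_of_nat (α := ℝ) (n := n))
  have hv : Integrable (fun θ => sesq (evalCirc Φ θ) v v) circMeasure :=
    h.integrable_sesq_const v
  let p : ℕ → ℝ → ℂ := fun n θ => (a n).sum fun m b => b * circ θ ^ m
  have hpc : ∀ n, Continuous (p n) := fun n =>
    continuous_finsetSum _ fun m _ => continuous_const.mul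
      (continuous_circ.zpow₀ m fun θ => Or.inl (circ_ne_zero θ))
  have hp : ∀ θ, Filter.Tendsto (fun n => p n θ) Filter.atTop (nhds (k (circ θ) : ℂ)) := fun θ => by
    rw [tendsto_iff_norm_sub_tendsto_zero]
    refine squeeze_zero (fun _ => norm_nonneg _) (fun n => ?_)
      (tendsto_one_div_add_atTop_nhds_zero_nat (𝕜 := ℝ))
    rw [norm_sub_rev]
    exact (ha n θ).le
  have hpb : ∀ n θ, ‖p n θ‖ ≤ K + 1 := fun n θ => by
    have h1 := (ha n θ).le
    have h2 : (1 : ℝ) / (n + 1) ≤ 1 := by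
      rw [div_le_one (by positivity)]
      linarith [(Nat.cast_nonneg n : (0 : ℝ) ≤ n)]
    have h3 := norm_sub_norm_le (p n θ) (k (circ θ) : ℂ)
    rw [norm_sub_rev, Complex.norm_real] at h3
    have := hK' θ
    simp only [p] at h3 ⊢
    linarith
  have hlim := tendsto_integral_norm_sq_mul hv hpc hpb hp
  choose r hr0 hr using fun n => h.integral_trigonometric_sesq (a n) v
  have hre := (Complex.continuous_re.tendsto _).comp hlim
  have him := (Complex.continuous_im.tendsto _).comp hlim
  constructor
  · refine ge_of_tendsto' hre fun n => ?_
    change 0 ≤ (∫ θ, ((‖p n θ‖ ^ 2 : ℝ) : ℂ) * sesq (evalCirc Φ θ) v v ∂circMeasure).re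
    rw [hr n, Complex.ofReal_re]
    exact hr0 n
  · refine tendsto_nhds_unique him (tendsto_const_nhds.congr fun n => ?_)
    change 0 = (∫ θ, ((‖p n θ‖ ^ 2 : ℝ) : ℂ) * sesq (evalCirc Φ θ) v v ∂circMeasure).im
    rw [hr n, Complex.ofReal_im]

/-- A spectral density is positive semidefinite almost everywhere on the unit circle. -/
theorem HasSpectralDensity.ae_isNonneg (h : HasSpectralDensity P x Φ) :
    ∀ᵐ θ ∂circMeasure, IsNonneg (evalCirc Φ θ) := by
  have hIoo : ∀ᵐ θ ∂circMeasure, θ ∈ Set.Ioo (-Real.pi) Real.pi := by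
    rw [circMeasure, ← Measure.restrict_congr_set Ioo_ae_eq_Ioc]
    exact ae_restrict_mem measurableSet_Ioo
  -- The exceptional set, the poles and the endpoint, does not depend on `v`, so all vectors are
  -- handled at once by continuity of the entries.
  filter_upwards [hIoo, ae_matrix_denom_ne_zero Φ] with θ₀ hθ hden v
  let S : ℂ → ℂ := fun z => sesq (Matrix.of fun i j => evalC (Φ i j) z) v v
  have hS : ∀ θ, S (circ θ) = sesq (evalCirc Φ θ) v v := fun θ => rfl
  have hSc : ContinuousAt S (circ θ₀) := by
    simp only [S, sesq_eq_sum, Matrix.of_apply]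
    refine tendsto_finsetSum _ fun i _ => tendsto_finsetSum _ fun j _ => ?_
    exact (tendsto_const_nhds.mul (continuousAt_evalC (hden i j))).mul tendsto_const_nhds
  have hv : Integrable (fun θ => S (circ θ)) circMeasure :=
    h.integrable_sesq_const v
  have hint : ∀ k : ℂ → ℝ, Continuous k →
      Integrable (fun θ => ((k (circ θ) ^ 2 : ℝ) : ℂ) * S (circ θ)) circMeasure := fun k hk => by
    obtain ⟨K, hK⟩ := (isCompact_sphere (0 : ℂ) 1).exists_bound_of_continuousOn hk.continuousOn
    refine hv.bdd_mul (c := K ^ 2) ?_ (Filter.Eventually.of_forall fun θ => ?_)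
    · exact (Complex.continuous_ofReal.comp
        ((hk.comp continuous_circ).pow 2)).aestronglyMeasurable
    · rw [Complex.norm_real, norm_pow]
      exact pow_le_pow_left₀ (norm_nonneg _) (hK _ (by simp [norm_circ])) 2
  have hre : ∀ k : ℂ → ℝ, Continuous k → 0 ≤ ∫ θ, k (circ θ) ^ 2 * (S (circ θ)).re ∂circMeasure := by
    intro k hk
    have h1 := (h.integral_sq_mul_sesq hk v).1
    have h2 := integral_re (𝕜 := ℂ) (hint k hk)
    simp only [RCLike.re_to_complex, Complex.re_ofReal_mul] at h2
    rw [h2]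
    exact h1
  have him : ∀ k : ℂ → ℝ, Continuous k → ∫ θ, k (circ θ) ^ 2 * (S (circ θ)).im ∂circMeasure = 0 := by
    intro k hk
    have h1 := (h.integral_sq_mul_sesq hk v).2
    have h2 := integral_im (𝕜 := ℂ) (hint k hk)
    simp only [RCLike.im_to_complex, Complex.im_ofReal_mul] at h2
    rw [h2]
    exact h1
  have r1 := nonneg_of_integral_sq_mul_nonneg hθ (g := fun z => (S z).re)
    (Complex.continuous_re.continuousAt.comp hSc) hv.re hre
  -- The imaginary part integrates to zero against all squares, so it and its negative are both
  -- nonnegative.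
  have r2 := nonneg_of_integral_sq_mul_nonneg hθ (g := fun z => (S z).im)
    (Complex.continuous_im.continuousAt.comp hSc) hv.im fun k hk => (him k hk).ge
  have r3 := nonneg_of_integral_sq_mul_nonneg hθ (g := fun z => -(S z).im)
    (Complex.continuous_im.continuousAt.comp hSc).neg hv.im.neg fun k hk => by
      simp only [mul_neg, integral_neg, him k hk, neg_zero, le_refl]
  exact ⟨r1, le_antisymm (neg_nonneg.mp r3) r2⟩

end Nonneg

/-! ### The energy in `L²(Φ dθ/2π)` and the filtering isometry. -/

section Energy

variable {ι : Type*} [Fintype ι] {Φ : Matrix ι ι (RatFunc ℝ)}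

theorem spectralEnergy_eq (Φ : Matrix ι ι (RatFunc ℝ)) (g : ℝ → ι → ℂ) :
    spectralEnergy Φ g = ENNReal.ofReal (1 / (2 * Real.pi)) *
      ∫⁻ θ, ENNReal.ofReal (sesq (evalCirc Φ θ) (g θ) (g θ)).re ∂circMeasure := rfl

theorem ofReal_one_div_two_pi_ne_zero : ENNReal.ofReal (1 / (2 * Real.pi)) ≠ 0 := by
  have := Real.pi_pos
  rw [Ne, ENNReal.ofReal_eq_zero, not_le]
  positivity

theorem measurable_sesq (Φ : Matrix ι ι (RatFunc ℝ)) {a b : ℝ → ι → ℂ}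
    (ha : ∀ i, Measurable fun θ => a θ i) (hb : ∀ i, Measurable fun θ => b θ i) :
    Measurable fun θ => sesq (evalCirc Φ θ) (a θ) (b θ) := by
  simp only [sesq_eq_sum]
  exact Finset.measurable_sum _ fun i _ => Finset.measurable_sum _ fun j _ =>
    ((ha i).mul (measurable_evalCirc Φ i j)).mul (Complex.continuous_conj.measurable.comp (hb j))

theorem measurable_energyDensity (Φ : Matrix ι ι (RatFunc ℝ)) {a : ℝ → ι → ℂ}
    (ha : ∀ i, Measurable fun θ => a θ i) :
    Measurable fun θ => ENNReal.ofReal (sesq (evalCirc Φ θ) (a θ) (a θ)).re :=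
  (Complex.measurable_re.comp (measurable_sesq Φ ha ha)).ennreal_ofReal

theorem spectralEnergy_congr_ae {κ ν : Type*} [Fintype κ] [Fintype ν]
    {Φ : Matrix κ κ (RatFunc ℝ)} {Ψ : Matrix ν ν (RatFunc ℝ)} {a : ℝ → κ → ℂ} {b : ℝ → ν → ℂ}
    (h : ∀ᵐ θ ∂circMeasure,
      sesq (evalCirc Φ θ) (a θ) (a θ) = sesq (evalCirc Ψ θ) (b θ) (b θ)) :
    spectralEnergy Φ a = spectralEnergy Ψ b := by
  rw [spectralEnergy_eq, spectralEnergy_eq]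
  congr 1
  exact lintegral_congr_ae (h.mono fun θ hθ => by simp only [hθ])

/-- The energy is a squared norm; the factors `2` from the parallelogram law replace the triangle
inequality. -/
theorem spectralEnergy_add_le (h : ∀ᵐ θ ∂circMeasure, IsNonneg (evalCirc Φ θ)) {a b : ℝ → ι → ℂ}
    (ha : ∀ i, Measurable fun θ => a θ i) :
    spectralEnergy Φ (fun θ => a θ + b θ) ≤ 2 * spectralEnergy Φ a + 2 * spectralEnergy Φ b := by
  simp only [spectralEnergy_eq]
  rw [mul_left_comm 2, mul_left_comm 2, ← mul_add]
  gcongr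
  rw [← lintegral_const_mul' _ _ ENNReal.ofNat_ne_top, ← lintegral_const_mul' _ _ ENNReal.ofNat_ne_top,
    ← lintegral_add_left ((measurable_energyDensity Φ ha).const_mul 2)]
  refine lintegral_mono_ae (h.mono fun θ hθ => ?_)
  have h2 : (2 : ENNReal) = ENNReal.ofReal 2 := by simp
  rw [h2, ← ENNReal.ofReal_mul zero_le_two, ← ENNReal.ofReal_mul zero_le_two,
    ← ENNReal.ofReal_add (mul_nonneg zero_le_two (hθ _).1) (mul_nonneg zero_le_two (hθ _).1)]
  exact ENNReal.ofReal_le_ofReal (hθ.re_sesq_add_le _ _)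

theorem spectralEnergy_neg (Φ : Matrix ι ι (RatFunc ℝ)) (a : ℝ → ι → ℂ) :
    spectralEnergy Φ (fun θ => -a θ) = spectralEnergy Φ a := by
  refine spectralEnergy_congr_ae (Filter.Eventually.of_forall fun θ => ?_)
  have : -a θ = (-1 : ℂ) • a θ := by simp
  rw [this, sesq_smul_left, sesq_smul_right]
  simp

theorem spectralEnergy_sub_le (h : ∀ᵐ θ ∂circMeasure, IsNonneg (evalCirc Φ θ)) {a b : ℝ → ι → ℂ}
    (ha : ∀ i, Measurable fun θ => a θ i) :
    spectralEnergy Φ (fun θ => a θ - b θ) ≤ 2 * spectralEnergy Φ a + 2 * spectralEnergy Φ b := by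
  rw [← spectralEnergy_neg Φ b]
  simp only [sub_eq_add_neg]
  exact spectralEnergy_add_le h ha

/-- The Cauchy-Schwarz inequality in `L²(Φ dθ/2π)`. -/
theorem lintegral_enorm_sesq_le (h : ∀ᵐ θ ∂circMeasure, IsNonneg (evalCirc Φ θ))
    {a b : ℝ → ι → ℂ} (ha : ∀ i, Measurable fun θ => a θ i) (hb : ∀ i, Measurable fun θ => b θ i) :
    ENNReal.ofReal (1 / (2 * Real.pi)) * ∫⁻ θ, ‖sesq (evalCirc Φ θ) (a θ) (b θ)‖ₑ ∂circMeasure ≤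
      spectralEnergy Φ a ^ (1 / 2 : ℝ) * spectralEnergy Φ b ^ (1 / 2 : ℝ) := by
  set q := fun (a : ℝ → ι → ℂ) θ => ENNReal.ofReal (sesq (evalCirc Φ θ) (a θ) (a θ)).re
  -- Hölder is applied to the square roots of the energy densities, whose product dominates the form
  -- by pointwise Cauchy–Schwarz.
  have hH := ENNReal.lintegral_mul_le_Lp_mul_Lq circMeasure (Real.HolderConjugate.two_two)
    (f := fun θ => q a θ ^ (1 / 2 : ℝ)) (g := fun θ => q b θ ^ (1 / 2 : ℝ))
    ((measurable_energyDensity Φ ha).pow_const _).aemeasurable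
    ((measurable_energyDensity Φ hb).pow_const _).aemeasurable
  have hpow : ∀ t : ENNReal, (t ^ (1 / 2 : ℝ)) ^ (2 : ℝ) = t := fun t => by
    rw [← ENNReal.rpow_mul]
    norm_num
  simp only [Pi.mul_apply, hpow] at hH
  rw [spectralEnergy_eq, spectralEnergy_eq, ENNReal.mul_rpow_of_nonneg _ _ (by norm_num),
    ENNReal.mul_rpow_of_nonneg _ _ (by norm_num), mul_mul_mul_comm]
  have hc : ∀ t : ENNReal, t ^ (1 / 2 : ℝ) * t ^ (1 / 2 : ℝ) = t := fun t => by
    rw [← ENNReal.rpow_add_of_nonneg _ _ (by norm_num) (by norm_num)]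
    norm_num
  rw [hc]
  gcongr
  refine le_trans (lintegral_mono_ae (h.mono fun θ hθ => ?_)) hH
  have hs : ‖sesq (evalCirc Φ θ) (a θ) (b θ)‖ₑ =
      ENNReal.ofReal (‖sesq (evalCirc Φ θ) (a θ) (b θ)‖ ^ 2) ^ (1 / 2 : ℝ) := by
    rw [← ofReal_norm, ENNReal.ofReal_rpow_of_nonneg (by positivity) (by norm_num),
      ← Real.sqrt_eq_rpow, Real.sqrt_sq (norm_nonneg _)]
  rw [← ENNReal.mul_rpow_of_nonneg _ _ (by norm_num), hs, ← ENNReal.ofReal_mul (hθ _).1]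
  gcongr
  exact hθ.norm_sesq_sq_le _ _

end Energy

theorem eLpNorm_two_sq_eq {Ω : Type*} [MeasurableSpace Ω] {P : Measure Ω} {f : Ω → ℝ} (hf : MemLp f 2 P) :
    eLpNorm f 2 P ^ 2 = ENNReal.ofReal (∫ ω, f ω * f ω ∂P) := by
  have h := eLpNorm_nnreal_pow_eq_lintegral (f := f) (μ := P) (p := 2) two_ne_zero
  simp only [NNReal.coe_ofNat, ENNReal.rpow_ofNat, ENNReal.coe_ofNat] at h
  have hi : Integrable (fun ω => f ω * f ω) P := hf.integrable_mul hf
  rw [h, ofReal_integral_eq_lintegral_ofReal hi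
    (Filter.Eventually.of_forall fun ω => mul_self_nonneg _)]
  refine lintegral_congr fun ω => ?_
  rw [← ofReal_norm, ← ENNReal.ofReal_pow (norm_nonneg _), Real.norm_eq_abs, sq_abs, sq]

section FinOutput

variable {Ω : Type*} [MeasurableSpace Ω] {P : Measure Ω} {ι : Type*} [Fintype ι]
  {x : ℤ → Ω → ι → ℝ} {Φ : Matrix ι ι (RatFunc ℝ)}

/-- The filtering isometry, for finite filters. -/
theorem HasSpectralDensity.eLpNorm_finOutput_sq (h : HasSpectralDensity P x Φ) (c : ℤ →₀ (ι → ℝ))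
    (t : ℤ) : eLpNorm (finOutput c x t) 2 P ^ 2 = spectralEnergy Φ (finTransfer c) := by
  have h1 := h.integral_finOutput_mul c c t t
  simp only [sub_self, zpow_zero, one_mul] at h1
  have hi := h.integrable_sesq_finTransfer c c
  have hpos := h.ae_isNonneg
  have hL := ofReal_integral_eq_lintegral_ofReal hi.re (hpos.mono fun θ hθ => (hθ _).1)
  simp only [RCLike.re_to_complex] at hL
  rw [eLpNorm_two_sq_eq (h.memLp_finOutput c t), spectralEnergy_eq, ← hL,
    ← ENNReal.ofReal_mul (by have := Real.pi_pos; positivity)]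
  congr 1
  have h2 := congrArg Complex.re h1
  rw [Complex.ofReal_re] at h2
  have h3 : (1 / (2 * Real.pi) : ℂ) = ((1 / (2 * Real.pi) : ℝ) : ℂ) := by push_cast; rfl
  rw [h2, h3, Complex.re_ofReal_mul]
  congr 1
  exact (integral_re (𝕜 := ℂ) hi).symm

theorem HasSpectralDensity.spectralEnergy_finTransfer_ne_top (h : HasSpectralDensity P x Φ)
    (c : ℤ →₀ (ι → ℝ)) : spectralEnergy Φ (finTransfer c) ≠ ⊤ := by
  rw [← h.eLpNorm_finOutput_sq c 0]
  exact ENNReal.pow_ne_top (h.memLp_finOutput c 0).2.ne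

end FinOutput

/-! ### Density of finite filters among rational transfer functions of finite energy. -/

theorem exists_common_denominator {ι : Type*} [Finite ι] (G : ι → RatFunc ℝ) :
    ∃ (D : Polynomial ℝ) (N : ι → Polynomial ℝ), D ≠ 0 ∧ ∀ i, ∀ z : ℂ, Polynomial.aeval z D ≠ 0 →
      evalC (G i) z = Polynomial.aeval z (N i) / Polynomial.aeval z D := by
  obtain ⟨⟨d, hd⟩, hint⟩ := IsLocalization.exist_integer_multiples_of_finite
    (nonZeroDivisors (Polynomial ℝ)) G
  choose N hN using hint
  have hd0 := nonZeroDivisors.ne_zero hd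
  refine ⟨d, N, hd0, fun i z hz => ?_⟩
  have hG : G i = algebraMap _ (RatFunc ℝ) (N i) / algebraMap _ (RatFunc ℝ) d := by
    rw [eq_div_iff (RatFunc.algebraMap_ne_zero hd0), hN i, Algebra.smul_def, mul_comm]
  rw [hG, evalC_div hz]

theorem aeval_conj (p : Polynomial ℝ) (z : ℂ) :
    Polynomial.aeval (starRingEnd ℂ z) p = starRingEnd ℂ (Polynomial.aeval z p) :=
  Polynomial.aeval_algHom_apply Complex.conjAe.toAlgHom z p

section Approximation

variable {Ω : Type*} [MeasurableSpace Ω] {P : Measure Ω} {ι : Type*} [Fintype ι]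
  {x : ℤ → Ω → ι → ℝ} {Φ : Matrix ι ι (RatFunc ℝ)}

theorem spectralEnergy_le_of_norm_le (Φ : Matrix ι ι (RatFunc ℝ)) {a : ℝ → ι → ℂ} {δ : ℝ}
    (hδ : 0 ≤ δ) (ha : ∀ᵐ θ ∂circMeasure, ∀ i, ‖a θ i‖ ≤ δ) :
    spectralEnergy Φ a ≤ ENNReal.ofReal (δ ^ 2) * (ENNReal.ofReal (1 / (2 * Real.pi)) *
      ∫⁻ θ, ENNReal.ofReal (∑ i, ∑ j, ‖evalCirc Φ θ i j‖) ∂circMeasure) := by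
  rw [spectralEnergy_eq, mul_left_comm (ENNReal.ofReal (δ ^ 2)),
    ← lintegral_const_mul' (ENNReal.ofReal (δ ^ 2)) _ ENNReal.ofReal_ne_top]
  refine mul_le_mul' le_rfl ?_
  refine lintegral_mono_ae (ha.mono fun θ hθ => ?_)
  rw [← ENNReal.ofReal_mul (by positivity)]
  refine ENNReal.ofReal_le_ofReal ((Complex.re_le_norm _).trans ?_)
  rw [sq]
  exact norm_sesq_le _ hδ hθ hθ

theorem HasSpectralDensity.lintegral_sum_norm_ne_top (h : HasSpectralDensity P x Φ) :
    ENNReal.ofReal (1 / (2 * Real.pi)) *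
      ∫⁻ θ, ENNReal.ofReal (∑ i, ∑ j, ‖evalCirc Φ θ i j‖) ∂circMeasure ≠ ⊤ := by
  refine ENNReal.mul_ne_top ENNReal.ofReal_ne_top ?_
  have hi : Integrable (fun θ => ∑ i, ∑ j, ‖evalCirc Φ θ i j‖) circMeasure :=
    integrable_finsetSum _ fun i _ => integrable_finsetSum _ fun j _ => (h.integrable i j).norm
  rw [← ofReal_integral_eq_lintegral_ofReal hi (Filter.Eventually.of_forall fun θ =>
    Finset.sum_nonneg fun i _ => Finset.sum_nonneg fun j _ => norm_nonneg _)]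
  exact ENNReal.ofReal_ne_top

/-- Continuous real transfer functions are limits of finite filters in `L²(Φ dθ/2π)`. -/
theorem HasSpectralDensity.exists_finTransfer_energy_lt_of_continuous
    (h : HasSpectralDensity P x Φ) {k : ι → ℂ → ℂ} (hk : ∀ i, Continuous (k i))
    (hreal : ∀ i z, k i (starRingEnd ℂ z) = starRingEnd ℂ (k i z)) {ε : ENNReal} (hε : 0 < ε) :
    ∃ c : ℤ →₀ (ι → ℝ),
      spectralEnergy Φ (fun θ => (fun i => k i (circ θ)) - finTransfer c θ) < ε := by
  set C := ENNReal.ofReal (1 / (2 * Real.pi)) *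
    ∫⁻ θ, ENNReal.ofReal (∑ i, ∑ j, ‖evalCirc Φ θ i j‖) ∂circMeasure
  have hC : C ≠ ⊤ := h.lintegral_sum_norm_ne_top
  have hlim : Filter.Tendsto (fun δ : ℝ => ENNReal.ofReal (δ ^ 2) * C) (nhdsWithin 0 (Set.Ioi 0))
      (nhds 0) := by
    have : Filter.Tendsto (fun δ : ℝ => ENNReal.ofReal (δ ^ 2) * C) (nhds 0)
        (nhds (ENNReal.ofReal ((0 : ℝ) ^ 2) * C)) :=
      ENNReal.Tendsto.mul_const
        ((ENNReal.continuous_ofReal.comp (continuous_pow 2)).tendsto 0) (Or.inr hC)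
    simp only [ne_eq, OfNat.ofNat_ne_zero, not_false_eq_true, zero_pow, ENNReal.ofReal_zero,
      zero_mul] at this
    exact this.mono_left nhdsWithin_le_nhds
  obtain ⟨δ, hδε, hδ⟩ := ((hlim.eventually_lt_const hε).and self_mem_nhdsWithin).exists
  obtain ⟨c, hc⟩ := exists_finTransfer_approx hk hreal (Set.mem_Ioi.mp hδ)
  refine ⟨c, lt_of_le_of_lt (spectralEnergy_le_of_norm_le Φ (le_of_lt hδ)
    (Filter.Eventually.of_forall fun θ i => ?_)) hδε⟩
  exact (hc θ i).le

/-- Real rational transfer functions of finite energy are limits of finite filters in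
`L²(Φ dθ/2π)`. -/
theorem HasSpectralDensity.exists_finTransfer_energy_lt (h : HasSpectralDensity P x Φ)
    (G : ι → RatFunc ℝ) (hG : spectralEnergy Φ (fun θ i => evalC (G i) (circ θ)) ≠ ⊤)
    {ε : ENNReal} (hε : 0 < ε) :
    ∃ c : ℤ →₀ (ι → ℝ),
      spectralEnergy Φ (fun θ i => evalC (G i) (circ θ) - finTransfer c θ i) < ε := by
  have hpos := h.ae_isNonneg
  obtain ⟨D, N, hD, hDN⟩ := exists_common_denominator G
  set g : ℝ → ι → ℂ := fun θ i => evalC (G i) (circ θ) with hg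
  have hgm : ∀ i, Measurable fun θ => g θ i := fun i => measurable_evalC_circ _
  let δ : ℕ → ℝ := fun n => 1 / ((n : ℝ) + 1)
  have hδ : ∀ n, 0 < δ n := fun n => Nat.one_div_pos_of_nat
  -- Regularization of `N / D` that stays continuous at poles on the circle. The error is `s n • g`
  -- with `0 ≤ s n ≤ 1` and `s n → 0` off the zeros of `D`, so the energy density of `g` dominates.
  let k : ℕ → ι → ℂ → ℂ := fun n i z =>
    Polynomial.aeval z (N i) * starRingEnd ℂ (Polynomial.aeval z D) /
      ((Complex.normSq (Polynomial.aeval z D) + δ n : ℝ) : ℂ)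
  have hden : ∀ n z, Complex.normSq (Polynomial.aeval z D) + δ n ≠ 0 := fun n z =>
    (add_pos_of_nonneg_of_pos (Complex.normSq_nonneg _) (hδ n)).ne'
  have hkc : ∀ n i, Continuous (k n i) := fun n i => by
    refine Continuous.div ?_ ?_ fun z => Complex.ofReal_ne_zero.mpr (hden n z)
    · exact (Polynomial.continuous_aeval _).mul
        (Complex.continuous_conj.comp (Polynomial.continuous_aeval _))
    · exact Complex.continuous_ofReal.comp
        ((Complex.continuous_normSq.comp (Polynomial.continuous_aeval _)).add continuous_const)
  have hkr : ∀ n i z, k n i (starRingEnd ℂ z) = starRingEnd ℂ (k n i z) := fun n i z => by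
    simp only [k, aeval_conj, map_div₀, map_mul, Complex.normSq_conj, Complex.conj_ofReal]
  let s : ℕ → ℝ → ℝ := fun n θ => δ n / (Complex.normSq (Polynomial.aeval (circ θ) D) + δ n)
  have hs0 : ∀ n θ, 0 ≤ s n θ := fun n θ =>
    div_nonneg (hδ n).le (add_nonneg (Complex.normSq_nonneg _) (hδ n).le)
  have hs1 : ∀ n θ, s n θ ≤ 1 := fun n θ =>
    div_le_one_of_le₀ (by linarith [Complex.normSq_nonneg (Polynomial.aeval (circ θ) D)])
      (add_nonneg (Complex.normSq_nonneg _) (hδ n).le)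
  have hdiff : ∀ n, ∀ᵐ θ ∂circMeasure, g θ - (fun i => k n i (circ θ)) = (s n θ : ℂ) • g θ := by
    intro n
    filter_upwards [ae_aeval_circ_ne_zero hD] with θ hθ
    ext i
    have h1 : g θ i = _ := hDN i _ hθ
    have h2 : (Complex.normSq (Polynomial.aeval (circ θ) D) : ℂ) =
      Polynomial.aeval (circ θ) D * starRingEnd ℂ (Polynomial.aeval (circ θ) D) :=
        (Complex.mul_conj _).symm
    have h3 := Complex.ofReal_ne_zero.mpr (hden n (circ θ))
    simp only [Pi.sub_apply, Pi.smul_apply, smul_eq_mul, k, s, h1, Complex.ofReal_div]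
    field_simp
    push_cast
    rw [h2]
    ring
  have hQ : ∀ n, ∀ᵐ θ ∂circMeasure,
      ENNReal.ofReal (sesq (evalCirc Φ θ) (g θ - fun i => k n i (circ θ))
        (g θ - fun i => k n i (circ θ))).re =
      ENNReal.ofReal (s n θ ^ 2 * (sesq (evalCirc Φ θ) (g θ) (g θ)).re) := fun n => by
    filter_upwards [hdiff n] with θ hθ
    rw [hθ, sesq_smul_left, sesq_smul_right, Complex.conj_ofReal, Complex.re_ofReal_mul,
      Complex.re_ofReal_mul, ← mul_assoc, sq]
  have hfin : ∫⁻ θ, ENNReal.ofReal (sesq (evalCirc Φ θ) (g θ) (g θ)).re ∂circMeasure ≠ ⊤ := by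
    intro htop
    apply hG
    rw [spectralEnergy_eq, htop, ENNReal.mul_top ofReal_one_div_two_pi_ne_zero]
  have hlim : Filter.Tendsto (fun n => spectralEnergy Φ (fun θ => g θ - fun i => k n i (circ θ)))
      Filter.atTop (nhds 0) := by
    simp only [spectralEnergy_eq]
    rw [← mul_zero (ENNReal.ofReal (1 / (2 * Real.pi)))]
    refine ENNReal.Tendsto.const_mul ?_ (Or.inr ENNReal.ofReal_ne_top)
    rw [← lintegral_zero (μ := circMeasure)]
    refine tendsto_lintegral_of_dominated_convergence _
      (fun n => measurable_energyDensity Φ fun i => (hgm i).sub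
        ((hkc n i).comp continuous_circ).measurable) (fun n => ?_) hfin ?_
    · filter_upwards [hQ n, hpos] with θ h1 h2
      rw [h1]
      refine ENNReal.ofReal_le_ofReal (mul_le_of_le_one_left (h2 _).1 ?_)
      exact pow_le_one₀ (hs0 n θ) (hs1 n θ)
    · filter_upwards [ae_all_iff.mpr hQ, ae_aeval_circ_ne_zero hD] with θ h1 h2
      simp only [h1]
      have hb : Complex.normSq (Polynomial.aeval (circ θ) D) ≠ 0 := by
        rwa [Ne, Complex.normSq_eq_zero]
      have hδ0 : Filter.Tendsto δ Filter.atTop (nhds 0) := tendsto_one_div_add_atTop_nhds_zero_nat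
      have hs : Filter.Tendsto (fun n => s n θ) Filter.atTop (nhds 0) := by
        have := hδ0.div ((tendsto_const_nhds (x := Complex.normSq (Polynomial.aeval (circ θ) D))).add
          hδ0) (by rwa [add_zero])
        rwa [zero_div] at this
      have := (ENNReal.continuous_ofReal.tendsto _).comp
        ((hs.pow 2).mul_const (sesq (evalCirc Φ θ) (g θ) (g θ)).re)
      simpa [Function.comp_def] using this
  have hε4 : 0 < ε / 4 := ENNReal.div_pos hε.ne' ENNReal.ofNat_ne_top
  obtain ⟨n, hn⟩ := (hlim.eventually_lt_const hε4).exists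
  obtain ⟨c, hc⟩ := h.exists_finTransfer_energy_lt_of_continuous (hkc n) (hkr n) hε4
  refine ⟨c, ?_⟩
  have hadd := spectralEnergy_add_le hpos (a := fun θ => g θ - fun i => k n i (circ θ))
    (b := fun θ => (fun i => k n i (circ θ)) - finTransfer c θ)
    (fun i => (hgm i).sub ((hkc n i).comp continuous_circ).measurable)
  simp only [sub_add_sub_cancel] at hadd
  refine lt_of_le_of_lt hadd ?_
  have h4 : 2 * (ε / 4) + 2 * (ε / 4) = ε := by
    rw [← add_mul, ← mul_div_assoc]
    norm_num
    rw [mul_comm, ENNReal.mul_div_cancel_right (by norm_num) (by norm_num)]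
  calc _ < 2 * (ε / 4) + 2 * (ε / 4) := by
        refine ENNReal.add_lt_add ?_ ?_
        · exact ENNReal.mul_lt_mul_right (by norm_num) (by norm_num) hn
        · exact ENNReal.mul_lt_mul_right (by norm_num) (by norm_num) hc
    _ = ε := h4

end Approximation

/-! ### Mean square limits and outputs of rational filters. -/

-- Joint continuity of the inner product of `L²`.
open Filter Topology in
theorem tendsto_integral_mul_of_eLpNorm {Ω : Type*} [MeasurableSpace Ω] {P : Measure Ω}
    {f g : Ω → ℝ} {f' g' : ℕ → Ω → ℝ} (hf : MemLp f 2 P) (hg : MemLp g 2 P)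
    (hf' : ∀ n, MemLp (f' n) 2 P) (hg' : ∀ n, MemLp (g' n) 2 P)
    (hff : Tendsto (fun n => eLpNorm (f' n - f) 2 P) atTop (𝓝 0))
    (hgg : Tendsto (fun n => eLpNorm (g' n - g) 2 P) atTop (𝓝 0)) :
    Tendsto (fun n => ∫ ω, f' n ω * g' n ω ∂P) atTop (𝓝 (∫ ω, f ω * g ω ∂P)) := by
  have key : ∀ {u v : Ω → ℝ} (hu : MemLp u 2 P) (hv : MemLp v 2 P),
      inner ℝ (hv.toLp v) (hu.toLp u) = ∫ ω, u ω * v ω ∂P := fun hu hv => by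
    rw [L2.inner_def]
    refine integral_congr_ae ?_
    filter_upwards [hu.coeFn_toLp, hv.coeFn_toLp] with ω h1 h2
    rw [h1, h2]
    rfl
  simp only [← key hf hg, ← key (hf' _) (hg' _)]
  exact ((Lp.tendsto_Lp_iff_tendsto_eLpNorm'' _ hg' _ hg).mpr hgg).inner
    ((Lp.tendsto_Lp_iff_tendsto_eLpNorm'' _ hf' _ hf).mpr hff)

theorem finTransfer_sub {ι : Type*} (c d : ℤ →₀ (ι → ℝ)) (θ : ℝ) :
    finTransfer (c - d) θ = finTransfer c θ - finTransfer d θ := by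
  ext i
  exact Finsupp.sum_sub_index fun k a b => by simp [sub_mul]

theorem finOutput_sub {Ω ι : Type*} [Fintype ι] (c d : ℤ →₀ (ι → ℝ)) (x : ℤ → Ω → ι → ℝ) (t : ℤ)
    (ω : Ω) : finOutput (c - d) x t ω = finOutput c x t ω - finOutput d x t ω :=
  Finsupp.sum_sub_index fun k a b => by simp [sub_mul, Finset.sum_sub_distrib]

section Limits

variable {ι : Type*} [Fintype ι] {Φ : Matrix ι ι (RatFunc ℝ)}

theorem lintegral_enorm_sesq_ne_top (h : ∀ᵐ θ ∂circMeasure, IsNonneg (evalCirc Φ θ))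
    {a b : ℝ → ι → ℂ} (ha : ∀ i, Measurable fun θ => a θ i) (hb : ∀ i, Measurable fun θ => b θ i)
    (hEa : spectralEnergy Φ a ≠ ⊤) (hEb : spectralEnergy Φ b ≠ ⊤) :
    ∫⁻ θ, ‖sesq (evalCirc Φ θ) (a θ) (b θ)‖ₑ ∂circMeasure ≠ ⊤ := by
  intro htop
  have := lintegral_enorm_sesq_le h ha hb
  rw [htop, ENNReal.mul_top ofReal_one_div_two_pi_ne_zero, top_le_iff] at this
  exact ENNReal.mul_ne_top (ENNReal.rpow_ne_top_of_nonneg (by norm_num) hEa)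
    (ENNReal.rpow_ne_top_of_nonneg (by norm_num) hEb) this

theorem integrable_sesq_of_energy (h : ∀ᵐ θ ∂circMeasure, IsNonneg (evalCirc Φ θ))
    {a b : ℝ → ι → ℂ} (ha : ∀ i, Measurable fun θ => a θ i) (hb : ∀ i, Measurable fun θ => b θ i)
    (hEa : spectralEnergy Φ a ≠ ⊤) (hEb : spectralEnergy Φ b ≠ ⊤) :
    Integrable (fun θ => sesq (evalCirc Φ θ) (a θ) (b θ)) circMeasure :=
  ⟨(measurable_sesq Φ ha hb).aestronglyMeasurable,
    (lintegral_enorm_sesq_ne_top h ha hb hEa hEb).lt_top⟩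

theorem integrable_zpow_mul {f : ℝ → ℂ} (hf : Integrable f circMeasure) (k : ℤ) :
    Integrable (fun θ => circ θ ^ k * f θ) circMeasure := by
  refine hf.bdd_mul (c := 1) ?_ (Filter.Eventually.of_forall fun θ => ?_)
  · exact (continuous_circ.zpow₀ k fun θ => Or.inl (circ_ne_zero θ)).aestronglyMeasurable
  · rw [norm_zpow, norm_circ, one_zpow]

open Filter Topology in
theorem tendsto_integral_zpow_mul_sesq (h : ∀ᵐ θ ∂circMeasure, IsNonneg (evalCirc Φ θ)) (k : ℤ)
    {a b : ℝ → ι → ℂ} {a' b' : ℕ → ℝ → ι → ℂ}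
    (ha : ∀ i, Measurable fun θ => a θ i) (hb : ∀ i, Measurable fun θ => b θ i)
    (ha' : ∀ n i, Measurable fun θ => a' n θ i) (hb' : ∀ n i, Measurable fun θ => b' n θ i)
    (hEa : spectralEnergy Φ a ≠ ⊤) (hEb : spectralEnergy Φ b ≠ ⊤)
    (hEa' : ∀ n, spectralEnergy Φ (a' n) ≠ ⊤) (hEb' : ∀ n, spectralEnergy Φ (b' n) ≠ ⊤)
    (hla : Tendsto (fun n => spectralEnergy Φ (fun θ => a θ - a' n θ)) atTop (𝓝 0))
    (hlb : Tendsto (fun n => spectralEnergy Φ (fun θ => b θ - b' n θ)) atTop (𝓝 0)) :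
    Tendsto (fun n => ∫ θ, circ θ ^ k * sesq (evalCirc Φ θ) (a' n θ) (b' n θ) ∂circMeasure) atTop
      (𝓝 (∫ θ, circ θ ^ k * sesq (evalCirc Φ θ) (a θ) (b θ) ∂circMeasure)) := by
  refine tendsto_integral_of_L1 _
    (integrable_zpow_mul (integrable_sesq_of_energy h ha hb hEa hEb) k).1
    (Eventually.of_forall fun n => integrable_zpow_mul
      (integrable_sesq_of_energy h (ha' n) (hb' n) (hEa' n) (hEb' n)) k) ?_
  set κ := ENNReal.ofReal (1 / (2 * Real.pi))
  have hκ : κ ≠ 0 := ofReal_one_div_two_pi_ne_zero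
  have hκ' : κ ≠ ⊤ := ENNReal.ofReal_ne_top
  -- The difference of the forms splits into one with left entry `a - a'` and one with right entry
  -- `b - b'`. Cauchy–Schwarz bounds each, and the energy of `b'` is controlled by those of `b` and
  -- `b - b'`.
  have hbd : ∀ n, ∫⁻ θ, ‖circ θ ^ k * sesq (evalCirc Φ θ) (a' n θ) (b' n θ) -
      circ θ ^ k * sesq (evalCirc Φ θ) (a θ) (b θ)‖ₑ ∂circMeasure ≤
      κ⁻¹ * (spectralEnergy Φ (fun θ => a θ - a' n θ) ^ (1 / 2 : ℝ) *
          (2 * spectralEnergy Φ b + 2 * spectralEnergy Φ (fun θ => b θ - b' n θ)) ^ (1 / 2 : ℝ) +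
        spectralEnergy Φ a ^ (1 / 2 : ℝ) *
          spectralEnergy Φ (fun θ => b θ - b' n θ) ^ (1 / 2 : ℝ)) := by
    intro n
    have e : ∀ θ, ‖circ θ ^ k * sesq (evalCirc Φ θ) (a' n θ) (b' n θ) -
        circ θ ^ k * sesq (evalCirc Φ θ) (a θ) (b θ)‖ₑ ≤
        ‖sesq (evalCirc Φ θ) (a θ - a' n θ) (b' n θ)‖ₑ +
          ‖sesq (evalCirc Φ θ) (a θ) (b θ - b' n θ)‖ₑ := fun θ => by
      rw [← mul_sub, enorm_mul]
      have h1 : ‖circ θ ^ k‖ₑ = 1 := by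
        rw [← ofReal_norm, norm_zpow, norm_circ, one_zpow, ENNReal.ofReal_one]
      rw [h1, one_mul, ← enorm_neg]
      refine le_trans (le_of_eq ?_) (enorm_add_le _ _)
      congr 1
      rw [sesq_sub_left, sesq_sub_right]
      ring
    refine (lintegral_mono e).trans ?_
    have hm1 : ∀ i, Measurable fun θ => (a θ - a' n θ) i := fun i => (ha i).sub (ha' n i)
    have hm2 : ∀ i, Measurable fun θ => (b θ - b' n θ) i := fun i => (hb i).sub (hb' n i)
    rw [lintegral_add_left (measurable_sesq Φ hm1 (hb' n)).enorm]
    have hinv : ∀ t : ENNReal, t = κ⁻¹ * (κ * t) := fun t => by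
      rw [← mul_assoc, ENNReal.inv_mul_cancel hκ hκ', one_mul]
    rw [hinv (_ + _), mul_add κ]
    refine mul_le_mul' le_rfl (add_le_add ?_ ?_)
    · refine (lintegral_enorm_sesq_le h hm1 (hb' n)).trans ?_
      gcongr
      have := spectralEnergy_sub_le h (a := b) (b := fun θ => b θ - b' n θ) hb
      simpa using this
    · exact lintegral_enorm_sesq_le h ha hm2
  refine tendsto_of_tendsto_of_tendsto_of_le_of_le tendsto_const_nhds ?_ (fun _ => zero_le) hbd
  have hsq : ∀ {u : ℕ → ENNReal} {l : ENNReal}, Tendsto u atTop (𝓝 l) →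
      Tendsto (fun n => u n ^ (1 / 2 : ℝ)) atTop (𝓝 (l ^ (1 / 2 : ℝ))) := fun hu => hu.ennrpow_const _
  have hz : (0 : ENNReal) ^ (1 / 2 : ℝ) = 0 := ENNReal.zero_rpow_of_pos (by norm_num)
  have h1 := hsq hla
  have h2 := hsq hlb
  rw [hz] at h1 h2
  have h3 : Tendsto (fun n => (2 * spectralEnergy Φ b +
      2 * spectralEnergy Φ (fun θ => b θ - b' n θ)) ^ (1 / 2 : ℝ)) atTop
      (𝓝 ((2 * spectralEnergy Φ b + 2 * 0) ^ (1 / 2 : ℝ))) :=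
    hsq (tendsto_const_nhds.add (ENNReal.Tendsto.const_mul hlb (Or.inr ENNReal.ofNat_ne_top)))
  have h4 : (2 * spectralEnergy Φ b + 2 * 0) ^ (1 / 2 : ℝ) ≠ ⊤ :=
    ENNReal.rpow_ne_top_of_nonneg (by norm_num)
      (by simpa using ENNReal.mul_ne_top ENNReal.ofNat_ne_top hEb)
  have h5 := ENNReal.Tendsto.mul h1 (Or.inr h4) h3 (Or.inr ENNReal.zero_ne_top)
  have h6 := ENNReal.Tendsto.const_mul (a := spectralEnergy Φ a ^ (1 / 2 : ℝ)) h2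
    (Or.inr (ENNReal.rpow_ne_top_of_nonneg (by norm_num) hEa))
  have h7 := ENNReal.Tendsto.const_mul (a := κ⁻¹) (h5.add h6) (Or.inr (ENNReal.inv_ne_top.mpr hκ))
  simpa using h7

end Limits

section Filter

variable {Ω : Type*} [MeasurableSpace Ω] {P : Measure Ω} {κ ι : Type*} [Fintype ι]
  {x : ℤ → Ω → ι → ℝ} {Φ : Matrix ι ι (RatFunc ℝ)}

/-- Each row is at finite distance from a finite filter, whose energy is finite. -/
theorem IsFilterOutput.spectralEnergy_ne_top {G : Matrix κ ι (RatFunc ℝ)} {r : ℤ → Ω → κ → ℝ}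
    (hx : HasSpectralDensity P x Φ) (hr : IsFilterOutput P Φ G x r) (j : κ) :
    spectralEnergy Φ (fun θ => evalCirc G θ j) ≠ ⊤ := by
  obtain ⟨c, hc, -⟩ := hr.2 j 1 one_pos
  have h := spectralEnergy_add_le hx.ae_isNonneg
    (a := fun θ => evalCirc G θ j - finTransfer c θ) (b := finTransfer c)
    (fun i => (measurable_evalCirc G j i).sub (continuous_finTransfer c i).measurable)
  simp only [sub_add_cancel] at h
  refine ne_top_of_le_ne_top (ENNReal.add_ne_top.mpr ⟨?_, ?_⟩) h
  · exact ENNReal.mul_ne_top ENNReal.ofNat_ne_top (hc.trans ENNReal.one_lt_top).ne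
  · exact ENNReal.mul_ne_top ENNReal.ofNat_ne_top (hx.spectralEnergy_finTransfer_ne_top c)

end Filter

section Filter

variable {Ω : Type*} [MeasurableSpace Ω] {P : Measure Ω} {κ ι : Type*} [Fintype ι]
  {x : ℤ → Ω → ι → ℝ} {Φ : Matrix ι ι (RatFunc ℝ)}

theorem evalCirc_mul_mul_paraConj [Finite κ] (G : Matrix κ ι (RatFunc ℝ))
    (Φ : Matrix ι ι (RatFunc ℝ)) :
    ∀ᵐ θ ∂circMeasure, ∀ i j, evalCirc (G * Φ * paraConj G) θ i j =
      sesq (evalCirc Φ θ) (evalCirc G θ i) (evalCirc G θ j) := by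
  filter_upwards [evalCirc_mul (G * Φ) (paraConj G), evalCirc_mul G Φ, evalCirc_paraConj G]
    with θ h1 h2 h3 i j
  rw [h1, h2, h3, Matrix.mul_assoc]
  rfl

open Filter Topology in
theorem IsFilterOutput.exists_seq {G : Matrix κ ι (RatFunc ℝ)} {r : ℤ → Ω → κ → ℝ}
    (hr : IsFilterOutput P Φ G x r) (j : κ) :
    ∃ c : ℕ → ℤ →₀ (ι → ℝ),
      Tendsto (fun n => spectralEnergy Φ (fun θ => evalCirc G θ j - finTransfer (c n) θ)) atTop
        (𝓝 0) ∧
      ∀ t, Tendsto (fun n => eLpNorm (finOutput (c n) x t - fun ω => r t ω j) 2 P) atTop (𝓝 0) := by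
  have hε : ∀ n : ℕ, (0 : ENNReal) < ((n : ENNReal) + 1)⁻¹ := fun n => by simp
  choose c hc hc' using fun n => hr.2 j _ (hε n)
  have hlim : Tendsto (fun n : ℕ => ((n : ENNReal) + 1)⁻¹) atTop (𝓝 0) := by
    have := ENNReal.tendsto_inv_nat_nhds_zero.comp (tendsto_add_atTop_nat 1)
    simpa [Function.comp_def] using this
  refine ⟨c, ?_, fun t => ?_⟩
  · exact tendsto_of_tendsto_of_tendsto_of_le_of_le tendsto_const_nhds hlim (fun _ => zero_le)
      fun n => (hc n).le
  · refine tendsto_of_tendsto_of_tendsto_of_le_of_le tendsto_const_nhds hlim (fun _ => zero_le)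
      fun n => ?_
    rw [eLpNorm_sub_comm]
    exact (hc' n t).le

/-- The covariances of filter outputs, in the frequency domain. -/
theorem IsFilterOutput.integral_mul {G : Matrix κ ι (RatFunc ℝ)} {r : ℤ → Ω → κ → ℝ}
    (hx : HasSpectralDensity P x Φ) (hr : IsFilterOutput P Φ G x r) (t s : ℤ) (i j : κ) :
    ((∫ ω, r t ω i * r s ω j ∂P : ℝ) : ℂ) = (1 / (2 * Real.pi) : ℂ) *
      ∫ θ, circ θ ^ (t - s) *
        sesq (evalCirc Φ θ) (evalCirc G θ i) (evalCirc G θ j) ∂circMeasure := by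
  obtain ⟨c, hcE, hcP⟩ := hr.exists_seq i
  obtain ⟨d, hdE, hdP⟩ := hr.exists_seq j
  have h1 := tendsto_integral_mul_of_eLpNorm (hr.1 t i) (hr.1 s j)
    (fun n => hx.memLp_finOutput (c n) t) (fun n => hx.memLp_finOutput (d n) s) (hcP t) (hdP s)
  have h2 := tendsto_integral_zpow_mul_sesq hx.ae_isNonneg (t - s)
    (fun k => measurable_evalCirc G i k) (fun k => measurable_evalCirc G j k)
    (fun n k => (continuous_finTransfer (c n) k).measurable)
    (fun n k => (continuous_finTransfer (d n) k).measurable)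
    (hr.spectralEnergy_ne_top hx i) (hr.spectralEnergy_ne_top hx j)
    (fun n => hx.spectralEnergy_finTransfer_ne_top _)
    (fun n => hx.spectralEnergy_finTransfer_ne_top _) hcE hdE
  refine tendsto_nhds_unique ((Complex.continuous_ofReal.tendsto _).comp h1) ?_
  refine (h2.const_mul (1 / (2 * Real.pi) : ℂ)).congr fun n => ?_
  exact (hx.integral_finOutput_mul (c n) (d n) t s).symm

/-- Filter outputs have mean zero. -/
theorem IsFilterOutput.integral_eq_zero [IsFiniteMeasure P] {G : Matrix κ ι (RatFunc ℝ)}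
    {r : ℤ → Ω → κ → ℝ} (hx : HasSpectralDensity P x Φ) (hr : IsFilterOutput P Φ G x r) (t : ℤ)
    (j : κ) : ∫ ω, r t ω j ∂P = 0 := by
  obtain ⟨c, -, hcP⟩ := hr.exists_seq j
  -- Pairing with the constant `1` turns the mean into an inner product, which passes to the limit.
  have hone : MemLp (fun _ : Ω => (1 : ℝ)) 2 P := memLp_const 1
  have h1 := tendsto_integral_mul_of_eLpNorm (hr.1 t j) hone
    (fun n => hx.memLp_finOutput (c n) t) (fun _ => hone) (hcP t) (by simp)
  have h0 : ∀ n, ∫ ω, finOutput (c n) x t ω * 1 ∂P = 0 := fun n => by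
    simp only [mul_one, finOutput_eq_sum]
    rw [integral_finsetSum _ fun p _ =>
      ((hx.stationary.memLp _ _).integrable one_le_two).const_mul _]
    refine Finset.sum_eq_zero fun p _ => ?_
    rw [integral_const_mul, hx.stationary.mean_zero, mul_zero]
  simp only [h0] at h1
  simp only [mul_one] at h1
  exact tendsto_nhds_unique h1 tendsto_const_nhds

/-- The output of the filter `G` has the spectral density `G Φ G^*`. -/
theorem IsFilterOutput.hasSpectralDensity [IsFiniteMeasure P] [Finite κ]
    {G : Matrix κ ι (RatFunc ℝ)} {r : ℤ → Ω → κ → ℝ} (hx : HasSpectralDensity P x Φ)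
    (hr : IsFilterOutput P Φ G x r) : HasSpectralDensity P r (G * Φ * paraConj G) := by
  have hae := evalCirc_mul_mul_paraConj G Φ
  refine ⟨⟨hr.1, hr.integral_eq_zero hx, fun t k i j => ?_⟩, fun i j => ?_, fun k i j => ?_⟩
  · have h1 := hr.integral_mul hx (t + k) t i j
    have h2 := hr.integral_mul hx k 0 i j
    rw [add_sub_cancel_left] at h1
    rw [sub_zero, ← h1] at h2
    exact (Complex.ofReal_injective h2).symm
  · refine (integrable_sesq_of_energy hx.ae_isNonneg (fun k => measurable_evalCirc G i k)
      (fun k => measurable_evalCirc G j k) (hr.spectralEnergy_ne_top hx i)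
      (hr.spectralEnergy_ne_top hx j)).congr ?_
    exact hae.mono fun θ hθ => (hθ i j).symm
  · rw [hr.integral_mul hx k 0 i j, sub_zero]
    congr 1
    refine integral_congr_ae (hae.mono fun θ hθ => ?_)
    simp only [hθ i j]

open Filter Topology in
/-- A filter with rows of finite energy has an output. -/
theorem HasSpectralDensity.exists_isFilterOutput (hx : HasSpectralDensity P x Φ)
    (G : Matrix κ ι (RatFunc ℝ)) (hG : ∀ j, spectralEnergy Φ (fun θ => evalCirc G θ j) ≠ ⊤) :
    ∃ w : ℤ → Ω → κ → ℝ, IsFilterOutput P Φ G x w := by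
  have hpos := hx.ae_isNonneg
  -- Summable rates `2⁻ⁿ`: energy errors below `B n ^ 2 / 4` give, after the two factors `2`, output
  -- distances below `B N`, as completeness of `L²` requires.
  let B : ℕ → ENNReal := fun n => 2⁻¹ ^ n
  have hB0 : ∀ n, B n ≠ 0 := fun n => pow_ne_zero _ (by simp)
  have hBt : ∀ n, B n ≠ ⊤ := fun n => ENNReal.pow_ne_top (by simp)
  have hBlim : Tendsto B atTop (𝓝 0) := by
    apply ENNReal.tendsto_pow_atTop_nhds_zero_of_lt_one
    norm_num
  have hBanti : Antitone B := fun m n h => pow_le_pow_right_of_le_one' (by norm_num) h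
  have key : ∀ j, ∃ c : ℕ → ℤ →₀ (ι → ℝ),
      (∀ n, spectralEnergy Φ (fun θ => evalCirc G θ j - finTransfer (c n) θ) < B n ^ 2 / 4) ∧
      ∀ t, ∃ f : Ω → ℝ, MemLp f 2 P ∧ ∀ n, eLpNorm (f - finOutput (c n) x t) 2 P ≤ B n := by
    intro j
    have hε : ∀ n, 0 < B n ^ 2 / 4 := fun n =>
      ENNReal.div_pos (pow_ne_zero _ (hB0 n)) ENNReal.ofNat_ne_top
    -- The filters are chosen before the time `t`, so the same ones serve all times.
    choose c hc using fun n => hx.exists_finTransfer_energy_lt (G j) (hG j) (hε n)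
    refine ⟨c, hc, fun t => ?_⟩
    have hcau : ∀ N n m, N ≤ n → N ≤ m →
        eLpNorm (finOutput (c n) x t - finOutput (c m) x t) 2 P < B N := by
      intro N n m hn hm
      have e1 : finOutput (c n) x t - finOutput (c m) x t = finOutput (c n - c m) x t := by
        ext ω
        exact (finOutput_sub _ _ _ _ _).symm
      have e2 : finTransfer (c n - c m) = fun θ => (evalCirc G θ j - finTransfer (c m) θ) -
          (evalCirc G θ j - finTransfer (c n) θ) := by
        ext θ : 1
        rw [finTransfer_sub, sub_sub_sub_cancel_left]
      have hle := spectralEnergy_sub_le hpos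
        (a := fun θ => evalCirc G θ j - finTransfer (c m) θ)
        (b := fun θ => evalCirc G θ j - finTransfer (c n) θ)
        (fun i => (measurable_evalCirc G j i).sub (continuous_finTransfer (c m) i).measurable)
      have hlt : ∀ k, N ≤ k →
          spectralEnergy Φ (fun θ => evalCirc G θ j - finTransfer (c k) θ) < B N ^ 2 / 4 :=
        fun k hk => (hc k).trans_le (by gcongr; exact hBanti hk)
      have hsum : 2 * (B N ^ 2 / 4) + 2 * (B N ^ 2 / 4) = B N ^ 2 := by
        rw [← add_mul, ← mul_div_assoc]
        norm_num
        rw [mul_comm, ENNReal.mul_div_cancel_right (by norm_num) (by norm_num)]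
      have hfin : eLpNorm (finOutput (c n - c m) x t) 2 P ^ 2 < B N ^ 2 := by
        rw [hx.eLpNorm_finOutput_sq, e2]
        refine hle.trans_lt (lt_of_lt_of_eq (ENNReal.add_lt_add ?_ ?_) hsum)
        · exact ENNReal.mul_lt_mul_right (by norm_num) (by norm_num) (hlt m hm)
        · exact ENNReal.mul_lt_mul_right (by norm_num) (by norm_num) (hlt n hn)
      rw [e1]
      exact lt_of_pow_lt_pow_left' 2 hfin
    have hsum : ∑' n, B n ≠ ⊤ := by
      simp only [B, ENNReal.tsum_geometric]
      simp
    obtain ⟨f, hf, hlim⟩ := Lp.cauchy_complete_eLpNorm one_le_two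
      (fun n => hx.memLp_finOutput (c n) t) hsum hcau
    refine ⟨f, hf, fun n => ?_⟩
    have hb : ∀ m, n ≤ m → eLpNorm (f - finOutput (c n) x t) 2 P ≤
        eLpNorm (finOutput (c m) x t - f) 2 P + B n := fun m hm => by
      rw [eLpNorm_sub_comm (finOutput (c m) x t)]
      have := eLpNorm_add_le (f := f - finOutput (c m) x t)
        (g := finOutput (c m) x t - finOutput (c n) x t)
        (hf.1.sub (hx.memLp_finOutput (c m) t).1)
        ((hx.memLp_finOutput (c m) t).1.sub (hx.memLp_finOutput (c n) t).1) one_le_two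
      rw [sub_add_sub_cancel] at this
      exact this.trans (add_le_add le_rfl (hcau n m n hm le_rfl).le)
    have hl2 := hlim.add_const (B n)
    rw [zero_add] at hl2
    exact ge_of_tendsto hl2 ((eventually_ge_atTop n).mono hb)
  choose c hc f hf hfc using key
  refine ⟨fun t ω j => f j t ω, fun t j => hf j t, fun j ε hε => ?_⟩
  have h4 : Tendsto (fun n => B n ^ 2 / 4) atTop (𝓝 0) := by
    have := ENNReal.Tendsto.div_const (ENNReal.Tendsto.pow (n := 2) hBlim) (b := 4)
      (Or.inr (by norm_num))
    simpa using this
  obtain ⟨n, h1, h2⟩ := ((h4.eventually_lt_const hε).and (hBlim.eventually_lt_const hε)).exists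
  exact ⟨c j n, (hc j n).trans h1, fun t => (hfc j t n).trans_lt h2⟩

end Filter

/-! ### Factorization of the density through its full-rank block. -/

theorem isUnit_det_of_rank_eq {K ι : Type*} [Field K] [Fintype ι] [DecidableEq ι]
    {A : Matrix ι ι K} (h : A.rank = Fintype.card ι) : IsUnit A.det := by
  rw [← Matrix.isUnit_iff_isUnit_det, ← Matrix.mulVec_surjective_iff_isUnit]
  have : LinearMap.range A.mulVecLin = ⊤ :=
    Submodule.eq_top_of_finrank_eq (by rw [Module.finrank_fintype_fun_eq_card]; exact h)
  exact LinearMap.range_eq_top.mp this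

/-- A matrix with an invertible principal block of full rank has a vanishing Schur complement. -/
theorem toBlocks₂₂_eq_of_rank_eq {K ι κ : Type*} [Field K] [Fintype ι] [DecidableEq ι] [Fintype κ]
    [DecidableEq κ] {M : Matrix (ι ⊕ κ) (ι ⊕ κ) K} (hM : M.rank = Fintype.card ι)
    (hA : M.toBlocks₁₁.rank = Fintype.card ι) :
    M.toBlocks₂₂ = M.toBlocks₂₁ * M.toBlocks₁₁⁻¹ * M.toBlocks₁₂ := by
  -- The columns of `L` already span the column space of `M`, since the ranks agree. The other
  -- columns are then `L * X`, and its two block rows determine `X` and the corner block.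
  set L := M.submatrix id Sum.inl with hL
  have hAu := isUnit_det_of_rank_eq hA
  have hle : LinearMap.range L.mulVecLin ≤ LinearMap.range M.mulVecLin := by
    rintro _ ⟨v, rfl⟩
    refine ⟨Sum.elim v 0, ?_⟩
    ext i
    simp [Matrix.mulVec, dotProduct, hL]
  have hrank : M.rank ≤ L.rank := by
    rw [hM, ← hA]
    exact L.rank_submatrix_le Sum.inl id
  have heq := Submodule.eq_of_le_of_finrank_le hle hrank
  have hcol : ∀ j : κ, ∃ v : ι → K, L.mulVec v = M.mulVec (Pi.single (Sum.inr j) 1) := fun j => by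
    have : M.mulVecLin (Pi.single (Sum.inr j) 1) ∈ LinearMap.range L.mulVecLin := by
      rw [heq]
      exact ⟨_, rfl⟩
    exact this
  choose v hv using hcol
  set X : Matrix ι κ K := Matrix.of fun i j => v j i
  have h1 : M.toBlocks₁₁ * X = M.toBlocks₁₂ := by
    ext i j
    have := congrFun (hv j) (Sum.inl i)
    rw [Matrix.mulVec_single_one] at this
    exact this
  have h2 : M.toBlocks₂₁ * X = M.toBlocks₂₂ := by
    ext i j
    have := congrFun (hv j) (Sum.inr i)
    rw [Matrix.mulVec_single_one] at this
    exact this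
  rw [← h1, ← h2, Matrix.mul_assoc, Matrix.nonsing_inv_mul_cancel_left _ _ hAu]

section ParaConj

variable {κ ι ν : Type*}

theorem paraConj_mul [Fintype ι] (A : Matrix κ ι (RatFunc ℝ)) (B : Matrix ι ν (RatFunc ℝ)) :
    paraConj (A * B) = paraConj B * paraConj A := by
  rw [paraConj, Matrix.map_mul, Matrix.transpose_mul]
  rfl

theorem paraConj_one [DecidableEq ι] : paraConj (1 : Matrix ι ι (RatFunc ℝ)) = 1 := by
  rw [paraConj, Matrix.map_one _ (map_zero _) (map_one _), Matrix.transpose_one]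

theorem det_paraConj [Fintype ι] [DecidableEq ι] (A : Matrix ι ι (RatFunc ℝ)) :
    (paraConj A).det = reciprocal A.det := by
  rw [paraConj, Matrix.det_transpose, RingHom.map_det]
  rfl

/-- Nonnegative forms are Hermitian, and an identity a.e. on the circle is an identity of rational
matrices. -/
theorem paraConj_eq_of_ae_isNonneg [Fintype ι] {Φ : Matrix ι ι (RatFunc ℝ)}
    (h : ∀ᵐ θ ∂circMeasure, IsNonneg (evalCirc Φ θ)) : paraConj Φ = Φ := by
  classical
  refine eq_of_ae_evalCirc_eq ?_
  filter_upwards [h, evalCirc_paraConj Φ] with θ h1 h2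
  rw [h2]
  ext i j
  have hs : ∀ i j, sesq (evalCirc Φ θ) (Pi.single i 1) (Pi.single j 1) = evalCirc Φ θ i j := by
    intro i j
    have : star (Pi.single j 1 : ι → ℂ) = Pi.single j 1 := by
      ext k
      by_cases hk : k = j <;> simp [hk]
    rw [sesq, this]
    simp
  rw [Matrix.conjTranspose_apply, ← hs, ← hs]
  exact h1.conj_sesq _ _

theorem evalCirc_one [DecidableEq ι] (θ : ℝ) : evalCirc (1 : Matrix ι ι (RatFunc ℝ)) θ = 1 := by
  ext i j
  rw [evalCirc, Matrix.of_apply, Matrix.one_apply, Matrix.one_apply]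
  split_ifs <;> simp [evalC]

theorem ae_det_evalCirc_ne_zero [Fintype ι] [DecidableEq ι] {A : Matrix ι ι (RatFunc ℝ)}
    (hA : IsUnit A.det) : ∀ᵐ θ ∂circMeasure, (evalCirc A θ).det ≠ 0 := by
  filter_upwards [evalCirc_mul A A⁻¹] with θ h
  rw [Matrix.mul_nonsing_inv _ hA, evalCirc_one] at h
  have := congrArg Matrix.det h
  rw [Matrix.det_one, Matrix.det_mul] at this
  exact left_ne_zero_of_mul (this ▸ one_ne_zero)

end ParaConj

/-- If the Schur complement vanishes, a para-Hermitian matrix is generated by its principal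
block. -/
theorem eq_fromRows_mul_mul_paraConj {ι κ : Type*} [Fintype ι] [DecidableEq ι] [Fintype κ]
    [DecidableEq κ] {Ψ : Matrix (ι ⊕ κ) (ι ⊕ κ) (RatFunc ℝ)} (hΨ : paraConj Ψ = Ψ)
    (hA : IsUnit Ψ.toBlocks₁₁.det)
    (hD : Ψ.toBlocks₂₂ = Ψ.toBlocks₂₁ * Ψ.toBlocks₁₁⁻¹ * Ψ.toBlocks₁₂) :
    Ψ = Matrix.fromRows 1 (Ψ.toBlocks₂₁ * Ψ.toBlocks₁₁⁻¹) * Ψ.toBlocks₁₁ *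
      paraConj (Matrix.fromRows 1 (Ψ.toBlocks₂₁ * Ψ.toBlocks₁₁⁻¹)) := by
  set A := Ψ.toBlocks₁₁ with hAd
  set F := Ψ.toBlocks₂₁ * A⁻¹
  have hent : ∀ a b, reciprocal (Ψ b a) = Ψ a b := fun a b => congrFun (congrFun hΨ a) b
  have hA' : paraConj A = A := by
    ext i j
    exact hent _ _
  have hC' : paraConj Ψ.toBlocks₂₁ = Ψ.toBlocks₁₂ := by
    ext i j
    exact hent _ _
  have hinv : paraConj A⁻¹ = A⁻¹ := by
    have h1 : paraConj A⁻¹ * A = 1 := by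
      conv_lhs => rw [← hA']
      rw [hA', ← hA', ← paraConj_mul, hA', Matrix.mul_nonsing_inv _ hA, paraConj_one]
    exact (Matrix.inv_eq_left_inv h1).symm
  have hFA : F * A = Ψ.toBlocks₂₁ := Matrix.nonsing_inv_mul_cancel_right _ _ hA
  have hF' : paraConj F = A⁻¹ * Ψ.toBlocks₁₂ := by rw [paraConj_mul, hinv, hC']
  have hL : paraConj (Matrix.fromRows (1 : Matrix ι ι (RatFunc ℝ)) F) =
      Matrix.fromCols 1 (paraConj F) := by
    ext i (j | j)
    · have := congrFun (congrFun (paraConj_one (ι := ι)) i) j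
      exact this
    · rfl
  rw [hL, Matrix.fromRows_mul, Matrix.fromRows_mul_fromCols, Matrix.one_mul, Matrix.mul_one,
    Matrix.mul_one, hFA, hF', Matrix.mul_nonsing_inv_cancel_left _ _ hA, ← Matrix.mul_assoc, ← hD]
  exact (Matrix.fromBlocks_toBlocks Ψ).symm

/-! ### The forward filter, its uniqueness and the noisy feedback. -/

theorem sesq_mul_mul_conjTranspose {ι ν : Type*} [Fintype ι] [Fintype ν] (L : Matrix ι ν ℂ)
    (M : Matrix ν ν ℂ) (v w : ι → ℂ) :
    sesq (L * M * L.conjTranspose) v w = sesq M (Matrix.vecMul v L) (Matrix.vecMul w L) := by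
  rw [sesq, sesq, Matrix.star_vecMul, ← Matrix.mulVec_mulVec, ← Matrix.mulVec_mulVec,
    Matrix.dotProduct_mulVec]

section Blocks

variable {ι κ : Type*} [Fintype ι] [Fintype κ]

theorem sesq_elim_zero_left (M : Matrix (ι ⊕ κ) (ι ⊕ κ) ℂ) (v w : κ → ℂ) :
    sesq M (Sum.elim 0 v) (Sum.elim 0 w) = sesq M.toBlocks₂₂ v w := by
  simp [sesq_eq_sum, Fintype.sum_sum_type, Matrix.toBlocks₂₂]

theorem finOutput_mapRange_inl {Ω : Type*} (c : ℤ →₀ (ι → ℝ)) (h0) (x : ℤ → Ω → ι ⊕ κ → ℝ)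
    (t : ℤ) (ω : Ω) :
    finOutput (c.mapRange (fun v => Sum.elim v (0 : κ → ℝ)) h0) x t ω =
      finOutput c (subprocess x Sum.inl) t ω := by
  rw [finOutput, Finsupp.sum_mapRange_index (by simp)]
  simp [finOutput, subprocess, Fintype.sum_sum_type]

theorem finOutput_mapRange_inr {Ω : Type*} (c : ℤ →₀ (κ → ℝ)) (h0) (x : ℤ → Ω → ι ⊕ κ → ℝ)
    (t : ℤ) (ω : Ω) :
    finOutput (c.mapRange (fun v => Sum.elim (0 : ι → ℝ) v) h0) x t ω =
      finOutput c (subprocess x Sum.inr) t ω := by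
  rw [finOutput, Finsupp.sum_mapRange_index (by simp)]
  simp [finOutput, subprocess, Fintype.sum_sum_type]

theorem finTransfer_mapRange_inl {ι κ : Type*} (c : ℤ →₀ (ι → ℝ)) (h0) (θ : ℝ) :
    finTransfer (c.mapRange (fun v => Sum.elim v (0 : κ → ℝ)) h0) θ =
      Sum.elim (finTransfer c θ) 0 := by
  ext (i | i) <;> rw [finTransfer, Finsupp.sum_mapRange_index (by simp)] <;> simp [finTransfer]

theorem finTransfer_mapRange_inr {ι κ : Type*} (c : ℤ →₀ (κ → ℝ)) (h0) (θ : ℝ) :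
    finTransfer (c.mapRange (fun v => Sum.elim (0 : ι → ℝ) v) h0) θ =
      Sum.elim (0 : ι → ℂ) (finTransfer c θ) := by
  ext (i | i) <;> rw [finTransfer, Finsupp.sum_mapRange_index (by simp)] <;> simp [finTransfer]

theorem finOutput_single [DecidableEq ι] {Ω : Type*} (i : ι) (x : ℤ → Ω → ι → ℝ) (t : ℤ) (ω : Ω) :
    finOutput (Finsupp.single 0 (Pi.single i 1)) x t ω = x t ω i := by
  rw [finOutput, Finsupp.sum_single_index (by simp)]
  simp [Pi.single_apply]

theorem finTransfer_single {ι : Type*} [DecidableEq ι] (i : ι) (θ : ℝ) :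
    finTransfer (Finsupp.single 0 (Pi.single i 1)) θ = Pi.single i 1 := by
  ext j
  rw [finTransfer, Finsupp.sum_single_index (by simp)]
  by_cases h : j = i <;> simp [h]

end Blocks

theorem HasSpectralDensity.subprocess {Ω : Type*} [MeasurableSpace Ω] {P : Measure Ω}
    {ι κ : Type*} {x : ℤ → Ω → ι → ℝ} {Φ : Matrix ι ι (RatFunc ℝ)} (h : HasSpectralDensity P x Φ)
    (s : κ → ι) : HasSpectralDensity P (subprocess x s) (Φ.submatrix s s) :=
  ⟨⟨fun t i => h.stationary.memLp t (s i), fun t i => h.stationary.mean_zero t (s i),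
    fun t k i j => h.stationary.covariance t k (s i) (s j)⟩,
    fun i j => h.integrable (s i) (s j), fun k i j => h.covariance_eq k (s i) (s j)⟩

theorem evalC_neg {f : RatFunc ℝ} {z : ℂ} (hf : Polynomial.aeval z f.denom ≠ 0) :
    evalC (-f) z = -evalC f z := by
  conv_lhs => rw [← RatFunc.num_div_denom f, ← neg_div, ← map_neg, evalC_div hf, map_neg, neg_div]
  rfl

/-- Without poles `H` is bounded on the circle, and the entries of `Φ` are integrable. -/
theorem HasSpectralDensity.spectralEnergy_ne_top_of_no_poles {Ω : Type*} [MeasurableSpace Ω]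
    {P : Measure Ω} {ι κ : Type*} [Fintype κ] {x : ℤ → Ω → κ → ℝ}
    {Φ : Matrix κ κ (RatFunc ℝ)} (h : HasSpectralDensity P x Φ) {H : Matrix ι κ (RatFunc ℝ)}
    (hH : ∀ i j, ∀ z : ℂ, ‖z‖ = 1 → Polynomial.aeval z (H i j).denom ≠ 0) (i : ι) :
    spectralEnergy Φ (fun θ => evalCirc H θ i) ≠ ⊤ := by
  choose C hC0 hC using fun j => bounded_evalC_circ (hH i j)
  refine ne_top_of_le_ne_top (ENNReal.mul_ne_top ENNReal.ofReal_ne_top h.lintegral_sum_norm_ne_top)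
    (spectralEnergy_le_of_norm_le Φ (δ := ∑ j, C j) (Finset.sum_nonneg fun j _ => hC0 j)
      (Filter.Eventually.of_forall fun θ j => ?_))
  exact (hC j θ).trans (Finset.single_le_sum (fun j _ => hC0 j) (Finset.mem_univ j))

theorem evalCirc_fromRows_one {ι κ : Type*} [DecidableEq ι] (F : Matrix κ ι (RatFunc ℝ)) (θ : ℝ) :
    evalCirc (Matrix.fromRows (1 : Matrix ι ι (RatFunc ℝ)) F) θ =
      Matrix.fromRows 1 (evalCirc F θ) := by
  ext (i | i) j
  · exact congrFun (congrFun (evalCirc_one (ι := ι) θ) i) j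
  · rfl

section Factor

variable {Ω : Type*} [MeasurableSpace Ω] {P : Measure Ω} {ι κ : Type*} [Fintype ι]
  [DecidableEq ι] [Fintype κ] [DecidableEq κ] {x : ℤ → Ω → ι ⊕ κ → ℝ}
  {Ψ : Matrix (ι ⊕ κ) (ι ⊕ κ) (RatFunc ℝ)}

/-- The error of a finite filter in predicting `y` from `u` is its distance to the transfer
function `F` in `L²(Φ_u dθ/2π)`. -/
theorem HasSpectralDensity.eLpNorm_sub_finOutput_sq (h : HasSpectralDensity P x Ψ)
    {F : Matrix κ ι (RatFunc ℝ)}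
    (hΨ : Ψ = Matrix.fromRows 1 F * Ψ.toBlocks₁₁ * paraConj (Matrix.fromRows 1 F))
    (c : ℤ →₀ (ι → ℝ)) (j : κ) (t : ℤ) :
    eLpNorm (fun ω => x t ω (Sum.inr j) - finOutput c (FactorModel.subprocess x Sum.inl) t ω) 2 P ^ 2 =
      spectralEnergy Ψ.toBlocks₁₁ (fun θ => evalCirc F θ j - finTransfer c θ) := by
  -- The prediction error is itself a finite filter of the joint process; its transfer row times
  -- `[1; F]` is `F_j - c`.
  set d : ℤ →₀ (ι ⊕ κ → ℝ) := Finsupp.single 0 (Pi.single (Sum.inr j) 1) -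
    c.mapRange (fun v => Sum.elim v (0 : κ → ℝ)) (by ext (i | i) <;> rfl) with hd
  have e1 : (fun ω => x t ω (Sum.inr j) - finOutput c (FactorModel.subprocess x Sum.inl) t ω) =
      finOutput d x t := by
    ext ω
    rw [hd, finOutput_sub, finOutput_single, finOutput_mapRange_inl]
  rw [e1, h.eLpNorm_finOutput_sq]
  refine spectralEnergy_congr_ae ?_
  set L : Matrix (ι ⊕ κ) ι (RatFunc ℝ) := Matrix.fromRows 1 F with hL
  filter_upwards [evalCirc_mul (L * Ψ.toBlocks₁₁) (paraConj L), evalCirc_mul L Ψ.toBlocks₁₁,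
    evalCirc_paraConj L] with θ h1 h2 h3
  have h4 : evalCirc Ψ θ = evalCirc L θ * evalCirc Ψ.toBlocks₁₁ θ * (evalCirc L θ).conjTranspose := by
    conv_lhs => rw [hΨ]
    rw [h1, h2, h3]
  have h5 : Matrix.vecMul (finTransfer d θ) (evalCirc L θ) = evalCirc F θ j - finTransfer c θ := by
    rw [hd, finTransfer_sub, finTransfer_single, finTransfer_mapRange_inl, Matrix.sub_vecMul, hL,
      evalCirc_fromRows_one, Matrix.sumElim_vecMul_fromRows, Matrix.vecMul_one,
      Matrix.zero_vecMul, add_zero, Matrix.single_one_vecMul]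
    rfl
  rw [h4, sesq_mul_mul_conjTranspose, h5]

theorem HasSpectralDensity.isFilterOutput_of_factor (h : HasSpectralDensity P x Ψ)
    {F : Matrix κ ι (RatFunc ℝ)}
    (hΨ : Ψ = Matrix.fromRows 1 F * Ψ.toBlocks₁₁ * paraConj (Matrix.fromRows 1 F)) :
    IsFilterOutput P Ψ.toBlocks₁₁ F (FactorModel.subprocess x Sum.inl)
      (FactorModel.subprocess x Sum.inr) := by
  refine ⟨fun t j => h.stationary.memLp t (Sum.inr j), fun j ε hε => ?_⟩
  have hfin : spectralEnergy Ψ.toBlocks₁₁ (fun θ => evalCirc F θ j) ≠ ⊤ := by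
    -- The zero filter identifies the energy of `F_j` with the variance of `y_j`, which is finite.
    have e := h.eLpNorm_sub_finOutput_sq hΨ 0 j 0
    simp only [show ∀ θ, finTransfer (0 : ℤ →₀ (ι → ℝ)) θ = 0 from fun θ => rfl, sub_zero] at e
    rw [← e]
    refine ENNReal.pow_ne_top (MemLp.sub (h.stationary.memLp 0 (Sum.inr j)) ?_).2.ne
    exact (h.subprocess Sum.inl).memLp_finOutput 0 0
  obtain ⟨c, hc⟩ := (h.subprocess Sum.inl).exists_finTransfer_energy_lt (F j) hfin
    (lt_min hε (ENNReal.pow_pos hε 2))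
  refine ⟨c, hc.trans_le (min_le_left _ _), fun t => ?_⟩
  refine lt_of_pow_lt_pow_left' 2 ?_
  change eLpNorm (fun ω => x t ω (Sum.inr j) - _) 2 P ^ 2 < ε ^ 2
  rw [h.eLpNorm_sub_finOutput_sq hΨ c j t]
  exact hc.trans_le (min_le_right _ _)

-- The filters that approximate `F'` have outputs tending to `y`, so by the error formula they
-- approximate `F` too. Hence `F' - F` has zero energy, and `Φ_u` is nonsingular almost everywhere.
open Filter Topology in
theorem HasSpectralDensity.eq_of_isFilterOutput (h : HasSpectralDensity P x Ψ)
    {F F' : Matrix κ ι (RatFunc ℝ)}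
    (hΨ : Ψ = Matrix.fromRows 1 F * Ψ.toBlocks₁₁ * paraConj (Matrix.fromRows 1 F))
    (hA : IsUnit Ψ.toBlocks₁₁.det)
    (hF' : IsFilterOutput P Ψ.toBlocks₁₁ F' (FactorModel.subprocess x Sum.inl)
      (FactorModel.subprocess x Sum.inr)) : F' = F := by
  have hu : HasSpectralDensity P (FactorModel.subprocess x Sum.inl) Ψ.toBlocks₁₁ :=
    h.subprocess Sum.inl
  have hpos := hu.ae_isNonneg
  have hrow : ∀ j, ∀ᵐ θ ∂circMeasure, evalCirc F' θ j = evalCirc F θ j := by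
    intro j
    obtain ⟨c, hcE, hcP⟩ := hF'.exists_seq j
    have hFc : Tendsto (fun n => spectralEnergy Ψ.toBlocks₁₁
        (fun θ => evalCirc F θ j - finTransfer (c n) θ)) atTop (𝓝 0) := by
      have h2 := ENNReal.Tendsto.pow (n := 2) (hcP 0)
      rw [zero_pow two_ne_zero] at h2
      refine h2.congr fun n => ?_
      rw [← h.eLpNorm_sub_finOutput_sq hΨ (c n) j 0, eLpNorm_sub_comm]
      rfl
    have hle : ∀ n, spectralEnergy Ψ.toBlocks₁₁ (fun θ => evalCirc F' θ j - evalCirc F θ j) ≤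
        2 * spectralEnergy Ψ.toBlocks₁₁ (fun θ => evalCirc F' θ j - finTransfer (c n) θ) +
          2 * spectralEnergy Ψ.toBlocks₁₁ (fun θ => evalCirc F θ j - finTransfer (c n) θ) := by
      intro n
      have := spectralEnergy_sub_le hpos (a := fun θ => evalCirc F' θ j - finTransfer (c n) θ)
        (b := fun θ => evalCirc F θ j - finTransfer (c n) θ) fun i =>
          (measurable_evalCirc F' j i).sub (continuous_finTransfer (c n) i).measurable
      simpa only [sub_sub_sub_cancel_right] using this
    have hlim := (ENNReal.Tendsto.const_mul (a := 2) hcE (Or.inr ENNReal.ofNat_ne_top)).add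
      (ENNReal.Tendsto.const_mul (a := 2) hFc (Or.inr ENNReal.ofNat_ne_top))
    rw [mul_zero, add_zero] at hlim
    have hzero := le_antisymm (ge_of_tendsto' hlim hle) zero_le
    rw [spectralEnergy_eq, mul_eq_zero, or_iff_right ofReal_one_div_two_pi_ne_zero] at hzero
    have hae := (lintegral_eq_zero_iff (measurable_energyDensity Ψ.toBlocks₁₁
      (a := fun θ => evalCirc F' θ j - evalCirc F θ j) fun i =>
        (measurable_evalCirc F' j i).sub (measurable_evalCirc F j i))).mp hzero
    filter_upwards [hae, hpos, ae_det_evalCirc_ne_zero hA] with θ h1 h2 h3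
    have h4 := le_antisymm (ENNReal.ofReal_eq_zero.mp h1) (h2 _).1
    exact sub_eq_zero.mp (h2.eq_zero_of_re_sesq_eq_zero h3 h4)
  refine eq_of_ae_evalCirc_eq ?_
  filter_upwards [ae_all_iff.mpr hrow] with θ hθ
  exact funext hθ

/-- The residual `u - H y` is the output of the filter `[1, -H]`. -/
theorem HasSpectralDensity.isFilterOutput_residual (h : HasSpectralDensity P x Ψ)
    {H : Matrix ι κ (RatFunc ℝ)} {w : ℤ → Ω → ι → ℝ}
    (hw : IsFilterOutput P Ψ.toBlocks₂₂ H (FactorModel.subprocess x Sum.inr) w) :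
    IsFilterOutput P Ψ (Matrix.fromCols 1 (-H)) x
      (fun t ω i => FactorModel.subprocess x Sum.inl t ω i - w t ω i) := by
  refine ⟨fun t i => (h.stationary.memLp t (Sum.inl i)).sub (hw.1 t i), fun i ε hε => ?_⟩
  obtain ⟨c, hcE, hcP⟩ := hw.2 i ε hε
  set d : ℤ →₀ (ι ⊕ κ → ℝ) := Finsupp.single 0 (Pi.single (Sum.inl i) 1) -
    c.mapRange (fun v => Sum.elim (0 : ι → ℝ) v) (by ext (i | i) <;> rfl) with hd
  refine ⟨d, ?_, fun t => ?_⟩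
  · refine lt_of_eq_of_lt ?_ hcE
    rw [← spectralEnergy_neg Ψ.toBlocks₂₂]
    refine spectralEnergy_congr_ae ?_
    filter_upwards [ae_matrix_denom_ne_zero H] with θ hθ
    have e : (fun k => evalCirc (Matrix.fromCols 1 (-H)) θ i k - finTransfer d θ k) =
        Sum.elim (0 : ι → ℂ) (-fun k => evalCirc H θ i k - finTransfer c θ k) := by
      rw [hd, finTransfer_sub, finTransfer_single, finTransfer_mapRange_inr]
      ext (k | k)
      · have := congrFun (congrFun (evalCirc_one (ι := ι) θ) i) k
        have h2 : evalCirc (Matrix.fromCols (1 : Matrix ι ι (RatFunc ℝ)) (-H)) θ i (Sum.inl k) =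
          evalCirc (1 : Matrix ι ι (RatFunc ℝ)) θ i k := rfl
        rw [h2, this]
        by_cases hk : k = i
        · subst hk
          simp
        · simp [hk, Ne.symm hk]
      · have h2 : evalCirc (Matrix.fromCols (1 : Matrix ι ι (RatFunc ℝ)) (-H)) θ i (Sum.inr k) =
          evalC (-H i k) (circ θ) := rfl
        rw [h2, evalC_neg (hθ i k)]
        simp [evalCirc]
        ring
    rw [e, sesq_elim_zero_left]
    rfl
  · refine lt_of_eq_of_lt ?_ (hcP t)
    rw [← eLpNorm_neg]
    congr 1
    ext ω
    simp only [Pi.neg_apply]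
    rw [hd, finOutput_sub, finOutput_single, finOutput_mapRange_inr]
    simp only [FactorModel.subprocess]
    ring

/-- Noisy feedback representation of a process with vanishing Schur complement. -/
theorem HasSpectralDensity.exists_isNoisyFeedback [IsFiniteMeasure P]
    (h : HasSpectralDensity P x Ψ) {F : Matrix κ ι (RatFunc ℝ)}
    (hΨ : Ψ = Matrix.fromRows 1 F * Ψ.toBlocks₁₁ * paraConj (Matrix.fromRows 1 F))
    (hA : IsUnit Ψ.toBlocks₁₁.det) :
    ∃ (H : Matrix ι κ (RatFunc ℝ)) (r : ℤ → Ω → ι → ℝ),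
      IsNoisyFeedback P Ψ.toBlocks₁₁ Ψ.toBlocks₂₂ (FactorModel.subprocess x Sum.inl)
        (FactorModel.subprocess x Sum.inr) F H r := by
  obtain ⟨H, hHp, hHc, hHs⟩ := exists_stabilizing_feedback F
  have hy : HasSpectralDensity P (FactorModel.subprocess x Sum.inr) Ψ.toBlocks₂₂ :=
    h.subprocess Sum.inr
  obtain ⟨w, hw⟩ := hy.exists_isFilterOutput H (hy.spectralEnergy_ne_top_of_no_poles hHc)
  refine ⟨H, fun t ω i => FactorModel.subprocess x Sum.inl t ω i - w t ω i,
    h.isFilterOutput_of_factor hΨ, ?_, hHp, hHs, _,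
    (h.isFilterOutput_residual hw).hasSpectralDensity h, ?_⟩
  · simpa only [sub_sub_cancel] using hw
  -- On substituting `y = F u`, the residual becomes `S u`: its density is `S Φ_u S^*`, and `det S`
  -- equals the determinant of the loop matrix.
  · set S := 1 - H * F with hS
    set G : Matrix ι (ι ⊕ κ) (RatFunc ℝ) := Matrix.fromCols 1 (-H) with hG
    set L : Matrix (ι ⊕ κ) ι (RatFunc ℝ) := Matrix.fromRows 1 F with hL
    have hSL : G * L = S := by
      rw [hG, hL, Matrix.fromCols_mul_fromRows, Matrix.one_mul, Matrix.neg_mul, ← sub_eq_add_neg]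
    have hSdet : S.det ≠ 0 := by
      have h1 := hHs.1
      rw [loopMatrix, Matrix.det_fromBlocks_one₂₂, Matrix.neg_mul, Matrix.mul_neg, neg_neg] at h1
      exact h1.ne_zero
    have e : G * Ψ * paraConj G = S * Ψ.toBlocks₁₁ * paraConj S := by
      conv_lhs => rw [hΨ]
      rw [← hSL, paraConj_mul]
      simp only [Matrix.mul_assoc]
    rw [e]
    refine Matrix.rank_of_det_ne_zero ?_
    rw [Matrix.det_mul, Matrix.det_mul, det_paraConj]
    exact mul_ne_zero (mul_ne_zero hSdet hA.ne_zero) (by rwa [Ne, map_eq_zero])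

end Factor

end FactorModel

end

theorem corollary2 {Ω : Type*} [MeasurableSpace Ω] (P : Measure Ω) [IsProbabilityMeasure P]
    {p m q : ℕ} (ζ : ℤ → Ω → Fin p → ℝ) (Φ : Matrix (Fin p) (Fin p) (RatFunc ℝ))
    (hζ : FactorModel.HasSpectralDensity P ζ Φ) (hrank : Φ.rank = m)
    (e : Fin m ⊕ Fin q ≃ Fin p)
    (hu : (Φ.submatrix (e ∘ Sum.inl) (e ∘ Sum.inl)).rank = m) :
    ∃ F : Matrix (Fin q) (Fin m) (RatFunc ℝ),
      F = Φ.submatrix (e ∘ Sum.inr) (e ∘ Sum.inl) *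
          (Φ.submatrix (e ∘ Sum.inl) (e ∘ Sum.inl))⁻¹ ∧
      (∀ F' : Matrix (Fin q) (Fin m) (RatFunc ℝ),
        FactorModel.IsFilterOutput P (Φ.submatrix (e ∘ Sum.inl) (e ∘ Sum.inl)) F'
          (FactorModel.subprocess ζ (e ∘ Sum.inl)) (FactorModel.subprocess ζ (e ∘ Sum.inr)) →
        F' = F) ∧
      ∃ (H : Matrix (Fin m) (Fin q) (RatFunc ℝ)) (r : ℤ → Ω → Fin m → ℝ),
        FactorModel.IsNoisyFeedback P
          (Φ.submatrix (e ∘ Sum.inl) (e ∘ Sum.inl)) (Φ.submatrix (e ∘ Sum.inr) (e ∘ Sum.inr))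
          (FactorModel.subprocess ζ (e ∘ Sum.inl)) (FactorModel.subprocess ζ (e ∘ Sum.inr))
          F H r := by
  -- Reordering the components by `e` preserves the rank and makes `u` and `y` the two blocks.
  set Ψ := Φ.submatrix e e with hΨ
  have h : FactorModel.HasSpectralDensity P (FactorModel.subprocess ζ e) Ψ := hζ.subprocess e
  have hM : Ψ.rank = Fintype.card (Fin m) := by
    rw [hΨ, Matrix.rank_submatrix, hrank, Fintype.card_fin]
  have hA : Ψ.toBlocks₁₁.rank = Fintype.card (Fin m) := hu.trans (Fintype.card_fin m).symm
  have hAu := FactorModel.isUnit_det_of_rank_eq hA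
  have hF := FactorModel.eq_fromRows_mul_mul_paraConj
    (FactorModel.paraConj_eq_of_ae_isNonneg h.ae_isNonneg) hAu
    (FactorModel.toBlocks₂₂_eq_of_rank_eq hM hA)
  exact ⟨_, rfl, fun F' hF' => h.eq_of_isFilterOutput hF hAu hF', h.exists_isNoisyFeedback hF hAu⟩
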